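/- **Theorem 3.3.** Let $x=(x^1,\dots,x^p)$ be independent and $u=(u^1,\dots,u^q)$ dependent variables. Let $u^\alpha_{\mathbf J}$ be the derivatives of $u$ ($\mathbf J=(j_1,\dots,j_p)$ a multi-index, $|\mathbf J|=j_1+\dots+j_p$), $D_i$ the total derivatives, $D_{\mathbf J}=D_1^{j_1}\cdots D_p^{j_p}$ and $(-D)_{\mathbf J}=(-1)^{|\mathbf J|}D_{\mathbf J}$. Write $f(x,[u])$ for a smooth function of $x$, $u$ and finitely many derivatives of $u$, and sum over repeated indices. All functions of $(x,[u])$ below are defined on a fixed open set $M$ of the jet space of order $n$ (respectively on its preimages in higher-order jet spaces and, for functions of $(x,[u;v])$, with no restriction on $v$ and its derivatives). Let $\mathcal A=\{F_\alpha(x,[u])=0,\ \alpha=1,\dots,q\}$ be a system of differential equations of order $n$ that is analytic and totally nondegenerate: for every $k\ge 0$, at every point at which the prolonged equations $D_{\mathbf J}F_\alpha=0$, $|\mathbf J|\le k$, hold, the Jacobian matrix of the functions $D_{\mathbf J}F_\alpha$, $|\mathbf J|\le k$, with respect to the jet coordinates has maximal rank, and the jet of order $n+k$ at that point is the jet of a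 smooth local solution of $\mathcal A$. Let $X=\xi^i(x,[u])\,\partial_{x^i}+\phi^\alpha(x,[u])\,\partial_{u^\alpha}$ generate a symmetry of $\mathcal A$, that is, $\operatorname{pr}X(F_\alpha)=0$ for all $\alpha$ on all smooth local solutions of $\mathcal A$, where $\operatorname{pr}X=\xi^iD_i+\sum_{\alpha,\mathbf J}(D_{\mathbf J}Q^\alpha)\,\partial_{u^\alpha_{\mathbf J}}$ and $Q^\alpha=\phi^\alpha-\xi^i D_iu^\alpha$. Let $v=(v^1,\dots,v^q)$ be dummy dependent variables and let $\widehat L(x,[u;v])=v^\alpha F_\alpha(x,[u])+L_0(x,[u])$ be any modified formal Lagrangian of $\mathcal A$, that is, $L_0$ is such that the modified adjoint system $\sum_{\mathbf J}(-D)_{\mathbf J}\,\partial\widehat L/\partial u^\alpha_{\mathbf J}=0$, $\alpha=1,\dots,q$, becomes equivalent to $\mathcal A$ (has the same local solutions) after the substitution $v=u$. Call a vector field a variational symmetry of $\int L\,\mathrm dx$ if its prolongation applied to $L$, plus $L\,D_i\xi^i$, equals $D_iA^i$ for some $p$-tuple $A$ of smooth differential functions ($\xi^i$ being the coefficients of $\partial_{x^i}$).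 If $X$ is a variational symmetry of the balance variational problem $\int L_0\,\mathrm dx$, then $X$ extends to a variational symmetry $$Y=X+\phi_*^\alpha(x,[u;v])\,\frac{\partial}{\partial v^\alpha}$$ of $\int\widehat L\,\mathrm dx$. Explicitly: there are finitely many functions $K^{\mathbf J}_{\alpha\beta}(x,[u])$ such that $$\operatorname{pr}X(F_\alpha)=\sum_{\beta,\mathbf J}K^{\mathbf J}_{\alpha\beta}\,D_{\mathbf J}F_\beta ,\qquad \alpha=1,\dots,q,$$ and, for every choice of such functions, $Y$ is a variational symmetry of $\int\widehat L\,\mathrm dx$ with $$\phi_*^\alpha=-\Big[\sum_{\beta,\mathbf J}(-D)_{\mathbf J}\big(v^\beta K^{\mathbf J}_{\beta\alpha}\big)+v^\alpha D_i\xi^i\Big].$$ -/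

import Mathlib

open scoped ContDiff

noncomputable section

namespace FormalLagrangian

/-- Multi-indices `J = (j₁, …, j_p)`. -/
abbrev MultiIndex (p : ℕ) : Type := Fin p → ℕ

/-- `|J| = j₁ + ⋯ + j_p`. -/
def MultiIndex.deg {p : ℕ} (J : MultiIndex p) : ℕ := ∑ i, J i

/-- Names of the jet coordinates: `Sum.inl i` is the independent variable `x^i`, and
`Sum.inr (a, J)` is the derivative `u^a_J` of the dependent variable `u^a`. -/
abbrev Coord (p : ℕ) (ι : Type) : Type := Fin p ⊕ (ι × MultiIndex p)

/-- The order of a jet coordinate (`0` for `x^i`, `|J|` for `u^a_J`). -/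
def Coord.order {p : ℕ} {ι : Type} : Coord p ι → ℕ
  | Sum.inl _ => 0
  | Sum.inr (_, J) => J.deg

/-- Points `(x, [u])` of the infinite jet space. Everything below depends on finitely many of the
coordinates only. -/
abbrev Jet (p : ℕ) (ι : Type) : Type := Coord p ι → ℝ

/-- The values of finitely many jet coordinates at a point. -/
def restr {p : ℕ} {ι : Type} (s : Finset (Coord p ι)) (z : Jet p ι) : s → ℝ := fun c => z c

/-- `M` is (the preimage of) an open subset of the jet space of order `n`. -/
def IsJetDomain {p : ℕ} {ι : Type} (n : ℕ) (M : Set (Jet p ι)) : Prop :=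
  ∃ (s : Finset (Coord p ι)) (O : Set (s → ℝ)),
    (∀ c ∈ s, c.order ≤ n) ∧ IsOpen O ∧ M = restr s ⁻¹' O

/-- `f(x,[u])` is a smooth differential function on `M`: a smooth function of finitely many jet
coordinates. -/
def IsSmoothFun {p : ℕ} {ι : Type} (M : Set (Jet p ι)) (f : Jet p ι → ℝ) : Prop :=
  ∃ (s : Finset (Coord p ι)) (g : (s → ℝ) → ℝ),
    ContDiffOn ℝ ∞ g (restr s '' M) ∧ ∀ z ∈ M, f z = g (restr s z)

/-- `f(x,[u])` is an analytic differential function of order at most `n` on `M`. -/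
def IsAnalyticFun {p : ℕ} {ι : Type} (n : ℕ) (M : Set (Jet p ι)) (f : Jet p ι → ℝ) : Prop :=
  ∃ (s : Finset (Coord p ι)) (g : (s → ℝ) → ℝ),
    (∀ c ∈ s, c.order ≤ n) ∧ AnalyticOnNhd ℝ g (restr s '' M) ∧ ∀ z ∈ M, f z = g (restr s z)

section Operators

variable {p : ℕ} {ι : Type} [DecidableEq ι]

/-- The partial derivative of `f` with respect to the jet coordinate `c`. -/
def pd (c : Coord p ι) (f : Jet p ι → ℝ) : Jet p ι → ℝ :=
  fun z => deriv (fun t => f (Function.update z c t)) (z c)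

/-- The total derivative `D_i = ∂/∂x^i + ∑_{a,J} u^a_{J+1_i} ∂/∂u^a_J`. At a point of a domain on
which `f` is a differential function, only finitely many terms are nonzero. -/
def totalDeriv (i : Fin p) (f : Jet p ι → ℝ) : Jet p ι → ℝ :=
  fun z => pd (Sum.inl i) f z +
    ∑ᶠ c : ι × MultiIndex p, z (Sum.inr (c.1, c.2 + Pi.single i 1)) * pd (Sum.inr c) f z

/-- `D_J = D_1^{j₁} ⋯ D_p^{j_p}`. -/
def totalDerivs (J : MultiIndex p) (f : Jet p ι → ℝ) : Jet p ι → ℝ :=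
  (List.finRange p).foldr (fun i g => (totalDeriv i)^[J i] g) f

/-- `(-D)_J = (-1)^{|J|} D_J`. -/
def negTotalDerivs (J : MultiIndex p) (f : Jet p ι → ℝ) : Jet p ι → ℝ :=
  fun z => (-1) ^ J.deg * totalDerivs J f z

/-- `Div A = D_i A^i`. -/
def divergence (A : Fin p → Jet p ι → ℝ) : Jet p ι → ℝ :=
  fun z => ∑ i, totalDeriv i (A i) z

/-- The Euler operator `E_{u^a} = ∑_J (-D)_J ∂/∂u^a_J`. -/
def euler (a : ι) (L : Jet p ι → ℝ) : Jet p ι → ℝ :=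
  fun z => ∑ᶠ J : MultiIndex p, negTotalDerivs J (pd (Sum.inr (a, J)) L) z

/-- The characteristic `Q^a = φ^a - ξ^i u^a_i` of `ξ^i ∂/∂x^i + φ^a ∂/∂u^a`. -/
def characteristic (ξ : Fin p → Jet p ι → ℝ) (φ : ι → Jet p ι → ℝ) (a : ι) : Jet p ι → ℝ :=
  fun z => φ a z - ∑ i, ξ i z * z (Sum.inr (a, Pi.single i 1))

/-- The prolongation `pr X = ξ^i D_i + ∑_{a,J} (D_J Q^a) ∂/∂u^a_J` of
`X = ξ^i ∂/∂x^i + φ^a ∂/∂u^a`, applied to `f`. -/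
def prolong (ξ : Fin p → Jet p ι → ℝ) (φ : ι → Jet p ι → ℝ) (f : Jet p ι → ℝ) : Jet p ι → ℝ :=
  fun z => ∑ i, ξ i z * totalDeriv i f z +
    ∑ᶠ c : ι × MultiIndex p, totalDerivs c.2 (characteristic ξ φ c.1) z * pd (Sum.inr c) f z

/-- `ξ^i(x,[u]) ∂/∂x^i + φ^a(x,[u]) ∂/∂u^a` is a smooth generalised vector field on `M`. -/
def IsVectorField (M : Set (Jet p ι)) (ξ : Fin p → Jet p ι → ℝ) (φ : ι → Jet p ι → ℝ) : Prop :=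
  (∀ i, IsSmoothFun M (ξ i)) ∧ ∀ a, IsSmoothFun M (φ a)

/-- The vector field is a (divergence) variational symmetry of the functional with Lagrangian `L`:
`pr X (L) + L D_i ξ^i = Div A` for some tuple `A` of differential functions. -/
def IsVariationalSymmetry (M : Set (Jet p ι)) (L : Jet p ι → ℝ)
    (ξ : Fin p → Jet p ι → ℝ) (φ : ι → Jet p ι → ℝ) : Prop :=
  IsVectorField M ξ φ ∧
    ∃ A : Fin p → Jet p ι → ℝ, (∀ i, IsSmoothFun M (A i)) ∧
      ∀ z ∈ M, prolong ξ φ L z + L z * divergence ξ z = divergence A z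

end Operators

section Solutions

variable {p : ℕ}

/-- The partial derivative of `h` in the direction of `x^i`. -/
def partialX (i : Fin p) (h : (Fin p → ℝ) → ℝ) : (Fin p → ℝ) → ℝ :=
  fun x => deriv (fun t => h (Function.update x i t)) (x i)

/-- `∂^{|J|} h / (∂x^1)^{j₁} ⋯ (∂x^p)^{j_p}`. -/
def partialXs (J : MultiIndex p) (h : (Fin p → ℝ) → ℝ) : (Fin p → ℝ) → ℝ :=
  (List.finRange p).foldr (fun i g => (partialX i)^[J i] g) h

/-- The jet at `x` of the function `u = f(x)`. -/
def jet {ι : Type} (f : (Fin p → ℝ) → ι → ℝ) (x : Fin p → ℝ) : Jet p ι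
  | Sum.inl i => x i
  | Sum.inr (a, J) => partialXs J (fun y => f y a) x

/-- `u = f(x)` is a smooth solution, on the open set `U`, of the system `F_α(x,[u]) = 0` on `M`. -/
def IsSolution {ι κ : Type} [Fintype ι] (M : Set (Jet p ι)) (F : κ → Jet p ι → ℝ)
    (U : Set (Fin p → ℝ)) (f : (Fin p → ℝ) → ι → ℝ) : Prop :=
  IsOpen U ∧ ContDiffOn ℝ ∞ f U ∧ ∀ x ∈ U, jet f x ∈ M ∧ ∀ α, F α (jet f x) = 0

variable {q : ℕ}

/-- The system `F_α = 0` of order `n` is totally nondegenerate. The `k`-th prolongation of the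
system is the system `D_J F_α = 0`, `|J| ≤ k`, of order `n + k`. For every `k` it is required, at
each point satisfying the prolonged equations, that their Jacobian matrix has maximal rank (linearly
independent rows), and that the jet of order `n + k` at the point is the jet of a local solution. -/
def IsTotallyNondegenerate (n : ℕ) (M : Set (Jet p (Fin q))) (F : Fin q → Jet p (Fin q) → ℝ) :
    Prop :=
  ∀ k : ℕ, ∀ z ∈ M, (∀ (J : MultiIndex p) (α : Fin q), J.deg ≤ k → totalDerivs J (F α) z = 0) →
    LinearIndependent ℝ
      (fun (r : {J : MultiIndex p // J.deg ≤ k} × Fin q) (c : Coord p (Fin q)) =>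
        pd c (totalDerivs r.1.1 (F r.2)) z) ∧
    ∃ (U : Set (Fin p → ℝ)) (f : (Fin p → ℝ) → Fin q → ℝ), IsSolution M F U f ∧
      (fun i => z (Sum.inl i)) ∈ U ∧
      ∀ c : Coord p (Fin q), c.order ≤ n + k → jet f (fun i => z (Sum.inl i)) c = z c

/-- The system `F_α = 0` admits the symmetry `X = ξ^i ∂/∂x^i + φ^α ∂/∂u^α`:
`pr X (F_α) = 0` on all solutions of the system. -/
def IsSymmetry (M : Set (Jet p (Fin q))) (F : Fin q → Jet p (Fin q) → ℝ)
    (ξ : Fin p → Jet p (Fin q) → ℝ) (φ : Fin q → Jet p (Fin q) → ℝ) : Prop :=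
  IsVectorField M ξ φ ∧
    ∀ (U : Set (Fin p → ℝ)) (f : (Fin p → ℝ) → Fin q → ℝ), IsSolution M F U f →
      ∀ x ∈ U, ∀ α, prolong ξ φ (F α) (jet f x) = 0

/-- The functions `K^J_{αβ}(x,[u])`, `J ∈ S`, express the symmetry condition as
`pr X (F_α) = ∑_{β,J} K^J_{αβ} D_J F_β`. -/
def IsMultiplier (M : Set (Jet p (Fin q))) (F : Fin q → Jet p (Fin q) → ℝ)
    (ξ : Fin p → Jet p (Fin q) → ℝ) (φ : Fin q → Jet p (Fin q) → ℝ)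
    (S : Finset (MultiIndex p)) (K : MultiIndex p → Fin q → Fin q → Jet p (Fin q) → ℝ) : Prop :=
  (∀ J ∈ S, ∀ α β, IsSmoothFun M (K J α β)) ∧
    ∀ z ∈ M, ∀ α,
      prolong ξ φ (F α) z = ∑ β, ∑ J ∈ S, K J α β z * totalDerivs J (F β) z

end Solutions

section Dummy

variable {p q : ℕ}

/-- Jets `(x,[u;v])`: the dependent variables are `u^α` (`Sum.inl α`) and `v^α` (`Sum.inr α`). -/
abbrev JetUV (p q : ℕ) : Type := Jet p (Fin q ⊕ Fin q)

/-- The projection `(x,[u;v]) ↦ (x,[u])`. -/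
def projU (w : JetUV p q) : Jet p (Fin q)
  | Sum.inl i => w (Sum.inl i)
  | Sum.inr (α, J) => w (Sum.inr (Sum.inl α, J))

/-- The substitution `v = u`, with all derivatives: `(x,[u]) ↦ (x,[u;u])`. -/
def substVU (z : Jet p (Fin q)) : JetUV p q
  | Sum.inl i => z (Sum.inl i)
  | Sum.inr (Sum.inl α, J) => z (Sum.inr (α, J))
  | Sum.inr (Sum.inr α, J) => z (Sum.inr (α, J))

/-- A function of `(x,[u])` as a function of `(x,[u;v])`. -/
def liftU (f : Jet p (Fin q) → ℝ) : JetUV p q → ℝ := fun w => f (projU w)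

/-- The coordinate `v^α`. -/
def vCoord (α : Fin q) : JetUV p q → ℝ := fun w => w (Sum.inr (Sum.inr α, 0))

/-- `L̂(x,[u;v]) = v^α F_α(x,[u]) + L₀(x,[u])`. -/
def modifiedLagrangian (F : Fin q → Jet p (Fin q) → ℝ) (L₀ : Jet p (Fin q) → ℝ) :
    JetUV p q → ℝ :=
  fun w => ∑ α, vCoord α w * liftU (F α) w + liftU L₀ w

/-- `L̂ = v^α F_α + L₀` is a modified formal Lagrangian of the system `F_α = 0` (and `L₀` a balance
function): the modified adjoint system `E_{u^α}(L̂) = 0` is, after the substitution `v = u`,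
equivalent to the system `F_α = 0`, that is, it has the same local solutions. The other half of the
Euler-Lagrange equations of `L̂`, the equations `E_{v^α}(L̂) = 0`, is the system itself. -/
def IsModifiedFormalLagrangian (M : Set (Jet p (Fin q))) (F : Fin q → Jet p (Fin q) → ℝ)
    (L₀ : Jet p (Fin q) → ℝ) : Prop :=
  IsSmoothFun M L₀ ∧
    ∀ (U : Set (Fin p → ℝ)) (f : (Fin p → ℝ) → Fin q → ℝ),
      IsSolution M
        (fun (α : Fin q) z => euler (Sum.inl α) (modifiedLagrangian F L₀) (substVU z)) U f ↔
      IsSolution M F U f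

/-- `φ_*^α = -[∑_{β,J} (-D)_J (v^β K^J_{βα}) + v^α D_i ξ^i]`. -/
def phiStar (ξ : Fin p → Jet p (Fin q) → ℝ) (S : Finset (MultiIndex p))
    (K : MultiIndex p → Fin q → Fin q → Jet p (Fin q) → ℝ) (α : Fin q) : JetUV p q → ℝ :=
  fun w => -((∑ β, ∑ J ∈ S, negTotalDerivs J (fun w' => vCoord β w' * liftU (K J β α) w') w) +
    vCoord α w * divergence (fun i => liftU (ξ i)) w)

end Dummy

end FormalLagrangian

end

open FormalLagrangian

/-! The existence of the multipliers is a division problem. Each `pr X(F_α)` depends on finitely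
many jet coordinates, say of order at most `k`. At a point where all `D_J F_β` with `|J| ≤ k`
vanish, nondegeneracy supplies a solution with the same jet up to order `n + k`, and the symmetry
condition on that solution makes `pr X(F_α)` vanish at the point. The differentials of the `D_J F_β`
are independent at such points, so Hadamard's lemma (`exists_eq_sum_mul_of_regular_zeros`) divides
with smooth coefficients; this is `exists_isMultiplier`.

The symmetry of the extended Lagrangian is integration by parts. Modulo divergences, `v^α pr X(F_α)
= v^α K^J_{αβ} D_J F_β` equals `(-D)_J(v^α K^J_{αβ}) F_β`. The coefficient `φ_*` is chosen so that
`φ_*^α F_α` cancels this together with `v^α F_α D_i ξ^i`. What remains is `pr X(L₀) + L₀ D_i ξ^i`, a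
divergence by assumption. This is `isVariationalSymmetry_modifiedLagrangian`.

The calculus rests on one observation (`ActsBy`): on functions of finitely many coordinates, total
derivatives and prolongations are vector fields `∑ w_c ∂/∂c`, so linearity and the Leibniz rule need
only one proof. -/

/-! ### Hadamard's lemma. -/

open MeasureTheory in
theorem contDiff_integral_zero_one {E : Type} [NormedAddCommGroup E] [NormedSpace ℝ E]
    {h : E × ℝ → ℝ} (hh : ContDiff ℝ ∞ h) :
    ContDiff ℝ ∞ (fun x => ∫ t in (0 : ℝ)..1, h (x, t)) := by
  -- The integral is the value at `0` of the convolution of the indicator of `(0, 1]` with `t ↦ χ t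
  -- * h (x, -t)`. The bump supplies the compact support needed for smooth dependence on `x` and
  -- equals `1` where the indicator is nonzero.
  let χ : ContDiffBump (0 : ℝ) := ⟨1, 2, one_pos, one_lt_two⟩
  let g : E → ℝ → ℝ := fun x t => χ t * h (x, -t)
  let f : ℝ → ℝ := (Set.Ioc (0 : ℝ) 1).indicator 1
  have hf : LocallyIntegrable f volume :=
    ((integrable_indicator_iff measurableSet_Ioc).2
      (integrableOn_const (by simp) (by simp) : IntegrableOn (fun _ => (1 : ℝ)) _ _)).locallyIntegrable
  have hg : ContDiffOn ℝ ∞ ↿g (Set.univ ×ˢ Set.univ) := by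
    have : ContDiff ℝ ∞ ↿g := by
      change ContDiff ℝ ∞ (fun q : E × ℝ => χ q.2 * h (q.1, -q.2))
      exact (χ.contDiff.comp contDiff_snd).mul
        (hh.comp (contDiff_fst.prodMk contDiff_snd.neg))
    exact this.contDiffOn
  have key := contDiffOn_convolution_right_with_param (μ := volume)
    (ContinuousLinearMap.mul ℝ ℝ) isOpen_univ (isCompact_closedBall (0 : ℝ) 2)
    (g := g) (f := f) (n := ⊤) (fun x t _ ht => by
      have : χ t = 0 := χ.zero_of_le_dist (by
        simp only [Metric.mem_closedBall, not_le] at ht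
        exact ht.le)
      simp [g, this]) hf hg
  rw [Set.univ_prod_univ, contDiffOn_univ] at key
  have h0 := key.comp (contDiff_id.prodMk (contDiff_const (c := (0 : ℝ))) : ContDiff ℝ ∞ fun x : E => (x, (0 : ℝ)))
  convert! h0 using 2 with x
  rw [intervalIntegral.integral_of_le zero_le_one, ← integral_indicator measurableSet_Ioc]
  simp only [Function.comp, convolution_def]
  congr 1
  ext t
  by_cases ht : t ∈ Set.Ioc (0 : ℝ) 1
  · have : χ (-t) = 1 := χ.one_of_mem_closedBall (by
      simp only [Metric.mem_closedBall, dist_zero_right, norm_neg, Real.norm_eq_abs]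
      rw [abs_of_pos ht.1]; exact ht.2)
    simp [ht, f, g, this]
  · simp [ht, f]

/-- Hadamard's lemma for a linear map with a right inverse. -/
theorem exists_eq_sum_mul_of_eq_zero_on_ker {E R : Type} [NormedAddCommGroup E] [NormedSpace ℝ E]
    [Fintype R] (L : E →L[ℝ] (R → ℝ)) (B : (R → ℝ) →L[ℝ] E) (hB : ∀ a, L (B a) = a)
    {f : E → ℝ} (hf : ContDiff ℝ ∞ f) (h0 : ∀ x, L x = 0 → f x = 0) :
    ∃ c : R → E → ℝ, (∀ r, ContDiff ℝ ∞ (c r)) ∧ ∀ x, f x = ∑ r, c r x * L x r := by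
  classical
  -- A segment from the projection of `x` to the kernel of `L` along the range of `B` (at `t = 0`,
  -- where `f` vanishes) to `x` itself (at `t = 1`). Integrating the derivative of `f` along it
  -- gives the coefficients.
  let γ : E × ℝ → E := fun q => q.1 - B (L q.1) + q.2 • B (L q.1)
  have hγ : ContDiff ℝ ∞ γ := by fun_prop
  have hf' : ContDiff ℝ ∞ (fderiv ℝ f) := hf.fderiv_right (by simp)
  let h : R → E × ℝ → ℝ := fun r q => fderiv ℝ f (γ q) (B (Pi.single r 1))
  have hh : ∀ r, ContDiff ℝ ∞ (h r) := fun r => (hf'.comp hγ).clm_apply contDiff_const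
  refine ⟨fun r x => ∫ t in (0 : ℝ)..1, h r (x, t), fun r => contDiff_integral_zero_one (hh r), ?_⟩
  intro x
  have hd : ∀ t : ℝ, HasDerivAt (fun t => f (γ (x, t))) (∑ r, h r (x, t) * L x r) t := by
    intro t
    have h1 : HasDerivAt (fun t => γ (x, t)) (B (L x)) t := by
      simpa [γ] using ((hasDerivAt_id t).smul_const (B (L x))).const_add (x - B (L x))
    have h2 := ((hf.differentiable (by simp)) (γ (x, t))).hasFDerivAt.comp_hasDerivAt t h1
    convert! h2 using 1
    have h3 : B (L x) = ∑ r, L x r • B (Pi.single r 1) := by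
      simp_rw [← map_smul, ← map_sum]
      congr 1
      ext r
      simp [Finset.sum_apply, Pi.single_apply]
    rw [h3, map_sum]
    simp [h, mul_comm]
  have hc : ∀ r, Continuous fun t : ℝ => h r (x, t) := fun r =>
    (hh r).continuous.comp (by fun_prop)
  have hint := intervalIntegral.integral_eq_sub_of_hasDerivAt (a := 0) (b := 1)
    (fun t _ => hd t)
    ((continuous_finsetSum _ fun r _ => (hc r).mul continuous_const).intervalIntegrable 0 1)
  rw [intervalIntegral.integral_finsetSum (f := fun r t => h r (x, t) * L x r)
    (fun r _ => ((hc r).mul continuous_const).intervalIntegrable 0 1)] at hint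
  simp_rw [intervalIntegral.integral_mul_const] at hint
  rw [hint]
  have : f (γ (x, 0)) = 0 := h0 _ (by simp [γ, hB])
  rw [this]
  simp [γ]

/-- By the inverse function theorem, independent differentials allow a local change of variables
that turns the `G r` into the components of a surjective linear map; the linear case then applies.
-/
theorem exists_eq_sum_mul_near_regular_zero {E R : Type} [NormedAddCommGroup E] [NormedSpace ℝ E]
    [FiniteDimensional ℝ E] [Fintype R] {O : Set E} (hO : IsOpen O) {G : R → E → ℝ}
    (hG : ∀ r, ContDiffOn ℝ ∞ (G r) O) {f : E → ℝ} (hf : ContDiffOn ℝ ∞ f O)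
    (h0 : ∀ x ∈ O, (∀ r, G r x = 0) → f x = 0) {a : E} (ha : a ∈ O)
    (hli : LinearIndependent ℝ fun r => fderiv ℝ (G r) a) :
    ∃ U : Set E, IsOpen U ∧ a ∈ U ∧ ∃ c : R → E → ℝ, (∀ r, ContDiffOn ℝ ∞ (c r) U) ∧
      ∀ x ∈ U, f x = ∑ r, c r x * G r x := by
  classical
  let g : E → R → ℝ := fun x r => G r x
  have hg : ContDiffOn ℝ ∞ g O := contDiffOn_pi.2 hG
  let L : E →L[ℝ] (R → ℝ) := ContinuousLinearMap.pi fun r => fderiv ℝ (G r) a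
  have hL : HasFDerivAt g L a := by
    rw [hasFDerivAt_pi]
    exact fun r => (((hG r).contDiffAt (hO.mem_nhds ha)).differentiableAt (by simp)).hasFDerivAt
  -- A nonzero functional that kills the range of `L` would be a linear relation between the
  -- differentials.
  obtain ⟨B, hB⟩ : ∃ B : (R → ℝ) →L[ℝ] E, ∀ b, L (B b) = b := by
    have hsurj : Function.Surjective (L : E →ₗ[ℝ] (R → ℝ)) := by
      rw [← LinearMap.range_eq_top]
      by_contra hne
      obtain ⟨m, hm0, hm⟩ := Submodule.exists_le_ker_of_lt_top _ (lt_top_iff_ne_top.2 hne)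
      apply hm0
      have h1 : ∑ r, m (Pi.single r 1) • fderiv ℝ (G r) a = 0 := by
        ext x
        have h2 : m (L x) = 0 := hm ⟨x, rfl⟩
        have h3 : L x = ∑ r, L x r • Pi.single r (1 : ℝ) := by
          ext r
          simp [Finset.sum_apply, Pi.single_apply]
        rw [h3, map_sum] at h2
        simpa [mul_comm, L] using h2
      have h4 := Fintype.linearIndependent_iff.1 hli _ h1
      refine LinearMap.pi_ext' fun r => LinearMap.ext_ring ?_
      simpa using h4 r
    obtain ⟨B, hB⟩ := LinearMap.exists_rightInverse_of_surjective _
      (LinearMap.range_eq_top.2 hsurj)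
    exact ⟨LinearMap.toContinuousLinearMap B, fun b => congrArg (fun e => e b) hB⟩
  -- Since `L B = 1`, this correction of the identity satisfies `L ∘ Ψ = g`; since `L` is the
  -- derivative of `g` at `a`, the derivative of `Ψ` there is the identity.
  let Ψ : E → E := fun x => x + B (g x - L x)
  have hΨ : ContDiffOn ℝ ∞ Ψ O :=
    contDiffOn_id.add (B.contDiff.comp_contDiffOn (hg.sub L.contDiff.contDiffOn))
  have hΨa : ContDiffAt ℝ ∞ Ψ a := hΨ.contDiffAt (hO.mem_nhds ha)
  have hΨ' : HasFDerivAt Ψ (ContinuousLinearEquiv.refl ℝ E : E →L[ℝ] E) a := by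
    have := (hasFDerivAt_id a).add (B.hasFDerivAt.comp a (hL.sub L.hasFDerivAt))
    convert! this using 1
    ext x
    simp
  have hLΨ : ∀ x, L (Ψ x) = g x := fun x => by simp [Ψ, hB]
  let e := hΨa.toOpenPartialHomeomorph Ψ hΨ' (by simp)
  have hae : a ∈ e.source := hΨa.mem_toOpenPartialHomeomorph_source hΨ' (by simp)
  have he : ∀ x, e x = Ψ x := fun x => rfl
  -- Smoothness of the inverse at a point needs an invertible derivative at its preimage, hence the
  -- last factor.
  let W : Set E := e.source ∩ O ∩
    fderiv ℝ Ψ ⁻¹' Set.range ((↑) : (E ≃L[ℝ] E) → E →L[ℝ] E)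
  have hW : W ∈ nhds a := by
    refine Filter.inter_mem (Filter.inter_mem (e.open_source.mem_nhds hae) (hO.mem_nhds ha)) ?_
    have hcont : ContinuousAt (fderiv ℝ Ψ) a :=
      ((hΨa.fderiv_right (m := ∞) (by simp)).continuousAt)
    refine hcont.preimage_mem_nhds (ContinuousLinearEquiv.isOpen.mem_nhds ?_)
    exact ⟨_, hΨ'.fderiv.symm⟩
  have hV : e.target ∩ e.symm ⁻¹' W ∈ nhds (Ψ a) := by
    have hat : Ψ a ∈ e.target := e.map_source hae
    refine Filter.inter_mem (e.open_target.mem_nhds hat) ?_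
    refine (e.continuousAt_symm hat).preimage_mem_nhds ?_
    rwa [← he a, e.left_inv hae]
  obtain ⟨ε, hε, hεV⟩ := Metric.nhds_basis_closedBall.mem_iff.1 hV
  let χ : ContDiffBump (Ψ a) := ⟨ε / 2, ε, half_pos hε, half_lt_self hε⟩
  have hinv : ∀ w ∈ Metric.closedBall (Ψ a) ε, Ψ (e.symm w) = w := fun w hw =>
    e.right_inv (hεV hw).1
  -- The linear case wants a function on all of `E`, so `f ∘ Ψ⁻¹` is cut off inside a ball on which
  -- the inverse is smooth.
  have hft : ContDiff ℝ ∞ (fun w => χ w * f (e.symm w)) := by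
    refine contDiff_iff_contDiffAt.2 fun w => ?_
    by_cases hw' : w ∈ Metric.closedBall (Ψ a) ε
    swap
    · refine (contDiffAt_const (c := (0 : ℝ))).congr_of_eventuallyEq ?_
      filter_upwards [Metric.isClosed_closedBall.isOpen_compl.mem_nhds hw'] with y hy
      rw [χ.zero_of_le_dist (not_le.1 fun h => hy h).le, zero_mul]
    obtain ⟨hwt, ⟨hws, hwO⟩, A, hA⟩ := hεV hw'
    have h1 : ContDiffAt ℝ ∞ Ψ (e.symm w) := hΨ.contDiffAt (hO.mem_nhds hwO)
    have h2 : HasFDerivAt e (A : E →L[ℝ] E) (e.symm w) := by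
      rw [hA]
      exact (h1.differentiableAt (by simp)).hasFDerivAt
    have h3 : ContDiffAt ℝ ∞ e.symm w := e.contDiffAt_symm hwt h2 h1
    exact χ.contDiffAt.mul ((hf.contDiffAt (hO.mem_nhds hwO)).comp w h3)
  have hft0 : ∀ w, L w = 0 → χ w * f (e.symm w) = 0 := by
    intro w hw
    by_cases hwε : w ∈ Metric.closedBall (Ψ a) ε
    · rw [h0 _ (hεV hwε).2.1.2, mul_zero]
      intro r
      have := hLΨ (e.symm w)
      rw [hinv w hwε, hw] at this
      exact congrFun this.symm r
    · rw [χ.zero_of_le_dist (not_le.1 hwε).le, zero_mul]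
  obtain ⟨c, hc, hcf⟩ := exists_eq_sum_mul_of_eq_zero_on_ker L B hB hft hft0
  refine ⟨e.source ∩ e ⁻¹' Metric.ball (Ψ a) (ε / 2) ∩ O,
    (e.isOpen_inter_preimage Metric.isOpen_ball).inter hO,
    ⟨⟨hae, Metric.mem_ball_self (half_pos hε)⟩, ha⟩, fun r x => c r (Ψ x), fun r => ?_, ?_⟩
  · exact (hc r).comp_contDiffOn (hΨ.mono Set.inter_subset_right)
  · rintro x ⟨⟨hxs, hxb⟩, hxO⟩
    have h1 := hcf (Ψ x)
    have h2 : e.symm (Ψ x) = x := e.left_inv hxs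
    have h3 : χ (Ψ x) = 1 := χ.one_of_mem_closedBall (Metric.ball_subset_closedBall hxb)
    rw [h3, h2, one_mul, hLΨ] at h1
    exact h1

open Manifold in
/-- Hadamard's lemma: a smooth function that vanishes on the common zeros of functions `G r` whose
differentials are independent there is a combination of the `G r` with smooth coefficients. -/
theorem exists_eq_sum_mul_of_regular_zeros {E R : Type} [NormedAddCommGroup E] [NormedSpace ℝ E]
    [FiniteDimensional ℝ E] [Fintype R] {O : Set E} (hO : IsOpen O) {G : R → E → ℝ}
    (hG : ∀ r, ContDiffOn ℝ ∞ (G r) O) {f : E → ℝ} (hf : ContDiffOn ℝ ∞ f O)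
    (h0 : ∀ x ∈ O, (∀ r, G r x = 0) → f x = 0)
    (hli : ∀ x ∈ O, (∀ r, G r x = 0) → LinearIndependent ℝ fun r => fderiv ℝ (G r) x) :
    ∃ c : R → E → ℝ, (∀ r, ContDiffOn ℝ ∞ (c r) O) ∧ ∀ x ∈ O, f x = ∑ r, c r x * G r x := by
  classical
  have hloc : ∀ a ∈ O, ∃ U : Set E, IsOpen U ∧ a ∈ U ∧ ∃ c : R → E → ℝ,
      (∀ r, ContDiffOn ℝ ∞ (c r) U) ∧ ∀ x ∈ U, f x = ∑ r, c r x * G r x := by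
    -- Away from the common zeros some `G r` is nonzero and can simply be divided by.
    intro a ha
    by_cases hz : ∀ r, G r a = 0
    · exact exists_eq_sum_mul_near_regular_zero hO hG hf h0 ha (hli a ha hz)
    · push Not at hz
      obtain ⟨r, hr⟩ := hz
      refine ⟨O ∩ G r ⁻¹' {0}ᶜ, (hG r).continuousOn.isOpen_inter_preimage hO isOpen_compl_singleton,
        ⟨ha, hr⟩, fun s x => if s = r then f x / G r x else 0, fun s => ?_, ?_⟩
      · by_cases hs : s = r
        · simp only [hs, if_true]
          exact (hf.mono Set.inter_subset_left).div ((hG r).mono Set.inter_subset_left)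
            fun x hx => hx.2
        · simp only [hs, if_false]
          exact contDiffOn_const
      · rintro x ⟨hxO, hx⟩
        simp only [ite_mul, zero_mul, Finset.sum_ite_eq', Finset.mem_univ, if_true]
        exact (div_mul_cancel₀ _ hx).symm
  let Ω : TopologicalSpace.Opens E := ⟨O, hO⟩
  have : ProperSpace E := FiniteDimensional.proper ℝ E
  have : LocallyCompactSpace Ω := hO.locallyCompactSpace
  -- The admissible coefficient vectors at a point form an affine, hence convex, set, so a partition
  -- of unity on `O` glues the local choices.
  obtain ⟨c, hc⟩ := exists_contMDiffMap_forall_mem_convex_of_local (n := ⊤) (M := Ω) (F := R → ℝ)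
    𝓘(ℝ, E) (t := fun x => {b | f x = ∑ r, b r * G r x}) (fun x b hb b' hb' s t _ _ hst => by
      simp only [Set.mem_ofPred_eq] at hb hb' ⊢
      simp only [Pi.add_apply, Pi.smul_apply, smul_eq_mul, add_mul, Finset.sum_add_distrib,
        mul_assoc, ← Finset.mul_sum, ← hb, ← hb']
      rw [← add_mul, hst, one_mul]) (fun x => by
      obtain ⟨U, hU, hxU, c, hc, hcf⟩ := hloc x x.2
      refine ⟨Subtype.val ⁻¹' U, (hU.preimage continuous_subtype_val).mem_nhds hxU,
        fun y r => c r y, ?_, fun y hy => hcf y hy⟩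
      have h1 : ContMDiffOn 𝓘(ℝ, E) 𝓘(ℝ, R → ℝ) ∞ (fun x r => c r x) U :=
        (contDiffOn_pi.2 hc).contMDiffOn
      exact h1.comp (contMDiff_subtype_val.contMDiffOn) fun y hy => hy)
  refine ⟨fun r x => if hx : x ∈ O then c ⟨x, hx⟩ r else 0, fun r => ?_, ?_⟩
  · intro x hx
    refine ContDiffAt.contDiffWithinAt ?_
    rw [← contMDiffAt_iff_contDiffAt]
    have h1 : ContMDiffAt 𝓘(ℝ, E) 𝓘(ℝ, ℝ) ∞ (fun y : Ω => c y r) ⟨x, hx⟩ :=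
      (contMDiffAt_pi_space.1 (c.contMDiff.contMDiffAt)) r
    have h2 : (fun y : Ω => c y r) =
        fun y : Ω => (fun x => if hx : x ∈ O then c ⟨x, hx⟩ r else 0) (y : E) := by
      ext y
      have : (y : E) ∈ O := y.2
      simp [this]
    rw [h2] at h1
    exact (contMDiffAt_subtype_iff (U := Ω) (x := ⟨x, hx⟩)).1 h1
  · intro x hx
    simpa [hx] using hc ⟨x, hx⟩

noncomputable section

namespace FormalLagrangian

/-! ### Functions of finitely many jet coordinates. -/

section Smooth

variable {p : ℕ} {ι : Type} {M : Set (Jet p ι)}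

theorem continuous_restr (s : Finset (Coord p ι)) : Continuous (restr (p := p) (ι := ι) s) :=
  continuous_pi fun c => continuous_apply (c : Coord p ι)

theorem IsJetDomain.isOpen {n : ℕ} (hM : IsJetDomain n M) : IsOpen M := by
  obtain ⟨s, O, -, hO, rfl⟩ := hM
  exact hO.preimage (continuous_restr s)

/-- The section of `restr s` through `z`. -/
def extendJet (s : Finset (Coord p ι)) (z : Jet p ι) (y : s → ℝ) : Jet p ι := by
  classical exact fun c => if h : c ∈ s then y ⟨c, h⟩ else z c

theorem restr_extendJet (s : Finset (Coord p ι)) (z : Jet p ι) (y : s → ℝ) :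
    restr s (extendJet s z y) = y := by
  ext c
  simp [restr, extendJet]

theorem extendJet_restr (s : Finset (Coord p ι)) (z : Jet p ι) :
    extendJet s z (restr s z) = z := by
  ext c
  simp [restr, extendJet]

theorem continuous_extendJet (s : Finset (Coord p ι)) (z : Jet p ι) :
    Continuous (extendJet s z) := by
  refine continuous_pi fun c => ?_
  by_cases h : c ∈ s
  · simpa [extendJet, h] using continuous_apply _
  · simpa [extendJet, h] using continuous_const

/-- The section through a point of `M` pulls `M` back to a neighbourhood. Openness lets smoothness
on the image be used as genuine differentiability. -/
theorem isOpen_image_restr (hM : IsOpen M) (s : Finset (Coord p ι)) :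
    IsOpen (restr s '' M) := by
  rw [isOpen_iff_mem_nhds]
  rintro _ ⟨z, hz, rfl⟩
  have h1 : extendJet s z ⁻¹' M ∈ nhds (restr s z) :=
    (hM.preimage (continuous_extendJet s z)).mem_nhds (by
      rwa [Set.mem_preimage, extendJet_restr])
  refine Filter.mem_of_superset h1 fun y hy => ⟨_, hy, restr_extendJet s z y⟩

theorem restr_update_of_mem [DecidableEq ι] {s : Finset (Coord p ι)} {c : Coord p ι} (hc : c ∈ s)
    (z : Jet p ι) (t : ℝ) :
    restr s (Function.update z c t) = Function.update (restr s z) ⟨c, hc⟩ t := by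
  ext d
  by_cases h : (d : Coord p ι) = c
  · obtain rfl : d = ⟨c, hc⟩ := Subtype.ext h
    simp [restr]
  · rw [Function.update_of_ne (fun h' => h (by rw [h']))]
    simp [restr, h]

theorem restr_update_of_notMem [DecidableEq ι] {s : Finset (Coord p ι)} {c : Coord p ι}
    (hc : c ∉ s) (z : Jet p ι) (t : ℝ) :
    restr s (Function.update z c t) = restr s z := by
  ext d
  have h : (d : Coord p ι) ≠ c := fun h => hc (h ▸ d.2)
  simp [restr, h]

/-- `f` is a smooth function of the jet coordinates in `s`. -/
def IsSmoothIn (M : Set (Jet p ι)) (s : Finset (Coord p ι)) (f : Jet p ι → ℝ) : Prop :=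
  ∃ g : (s → ℝ) → ℝ, ContDiffOn ℝ ∞ g (restr s '' M) ∧ ∀ z ∈ M, f z = g (restr s z)

theorem IsSmoothIn.mono {s t : Finset (Coord p ι)} {f : Jet p ι → ℝ}
    (h : IsSmoothIn M s f) (hst : s ⊆ t) : IsSmoothIn M t f := by
  obtain ⟨g, hg, hfg⟩ := h
  refine ⟨fun y => g fun c => y ⟨c, hst c.2⟩, ?_, fun z hz => hfg z hz⟩
  refine hg.comp (t := restr s '' M) (f := fun (y : t → ℝ) (c : s) => y ⟨c, hst c.2⟩)
    (ContDiff.contDiffOn (contDiff_pi.2 fun c => contDiff_apply ℝ ℝ _)) ?_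
  rintro _ ⟨z, hz, rfl⟩
  exact ⟨z, hz, rfl⟩

theorem IsSmoothIn.congr {s : Finset (Coord p ι)} {f f' : Jet p ι → ℝ}
    (h : IsSmoothIn M s f) (hf : ∀ z ∈ M, f' z = f z) : IsSmoothIn M s f' := by
  obtain ⟨g, hg, hfg⟩ := h
  exact ⟨g, hg, fun z hz => (hf z hz).trans (hfg z hz)⟩

theorem IsSmoothFun.congr {f f' : Jet p ι → ℝ}
    (h : IsSmoothFun M f) (hf : ∀ z ∈ M, f' z = f z) : IsSmoothFun M f' := by
  obtain ⟨s, hs⟩ := h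
  exact ⟨s, IsSmoothIn.congr hs hf⟩

/-- The set `s₀` forces prescribed coordinates into the common set, for instance those in which
derivatives will be taken. -/
theorem exists_isSmoothIn_of_finite {κ : Type} [Finite κ] {f : κ → Jet p ι → ℝ}
    (hf : ∀ k, IsSmoothFun M (f k)) (s₀ : Finset (Coord p ι)) :
    ∃ s, s₀ ⊆ s ∧ ∀ k, IsSmoothIn M s (f k) := by
  classical
  cases nonempty_fintype κ
  choose s hs using hf
  refine ⟨s₀ ∪ Finset.univ.biUnion s, Finset.subset_union_left, fun k => ?_⟩
  exact IsSmoothIn.mono (hs k) ((Finset.subset_biUnion_of_mem s (Finset.mem_univ k)).trans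
    Finset.subset_union_right)

theorem isSmoothFun_const (a : ℝ) : IsSmoothFun M fun _ => a :=
  ⟨∅, fun _ => a, contDiffOn_const, fun _ _ => rfl⟩

theorem isSmoothFun_coord (c : Coord p ι) : IsSmoothFun M fun z => z c :=
  ⟨{c}, fun y => y ⟨c, Finset.mem_singleton_self c⟩,
    (contDiff_apply ℝ ℝ _).contDiffOn, fun _ _ => rfl⟩

theorem IsSmoothFun.exists_common {f f' : Jet p ι → ℝ} (hf : IsSmoothFun M f)
    (hf' : IsSmoothFun M f') (s₀ : Finset (Coord p ι)) :
    ∃ s, s₀ ⊆ s ∧ IsSmoothIn M s f ∧ IsSmoothIn M s f' := by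
  obtain ⟨s, h0, hs⟩ := exists_isSmoothIn_of_finite (f := fun b : Bool => if b then f else f')
    (by rintro (_ | _) <;> simpa) s₀
  exact ⟨s, h0, by simpa using hs true, by simpa using hs false⟩

theorem IsSmoothFun.add {f f' : Jet p ι → ℝ} (hf : IsSmoothFun M f) (hf' : IsSmoothFun M f') :
    IsSmoothFun M fun z => f z + f' z := by
  obtain ⟨s, -, ⟨g, hg, hfg⟩, g', hg', hfg'⟩ := hf.exists_common hf' ∅
  exact ⟨s, _, hg.add hg', fun z hz => by simp [hfg z hz, hfg' z hz]⟩

theorem IsSmoothFun.mul {f f' : Jet p ι → ℝ} (hf : IsSmoothFun M f) (hf' : IsSmoothFun M f') :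
    IsSmoothFun M fun z => f z * f' z := by
  obtain ⟨s, -, ⟨g, hg, hfg⟩, g', hg', hfg'⟩ := hf.exists_common hf' ∅
  exact ⟨s, _, hg.mul hg', fun z hz => by simp [hfg z hz, hfg' z hz]⟩

theorem IsSmoothFun.neg {f : Jet p ι → ℝ} (hf : IsSmoothFun M f) :
    IsSmoothFun M fun z => -f z := by
  simpa using (isSmoothFun_const (-1)).mul hf

theorem IsSmoothFun.sub {f f' : Jet p ι → ℝ} (hf : IsSmoothFun M f) (hf' : IsSmoothFun M f') :
    IsSmoothFun M fun z => f z - f' z := by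
  simpa [sub_eq_add_neg] using hf.add hf'.neg

theorem IsSmoothFun.sum {κ : Type} {f : κ → Jet p ι → ℝ} (T : Finset κ)
    (hf : ∀ k ∈ T, IsSmoothFun M (f k)) : IsSmoothFun M fun z => ∑ k ∈ T, f k z := by
  classical
  induction T using Finset.induction_on with
  | empty => simpa using isSmoothFun_const 0
  | insert k T hk ih =>
    simp only [Finset.sum_insert hk]
    exact (hf k (Finset.mem_insert_self k T)).add
      (ih fun j hj => hf j (Finset.mem_insert_of_mem hj))

end Smooth

/-! ### Partial derivatives in jet coordinates. -/

section PartialDerivatives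

variable {p : ℕ} {ι : Type} [DecidableEq ι] {M : Set (Jet p ι)}

theorem eventually_update_mem (hM : IsOpen M) {z : Jet p ι} (hz : z ∈ M) (c : Coord p ι) :
    ∀ᶠ t in nhds (z c), Function.update z c t ∈ M := by
  have : Continuous fun t : ℝ => Function.update z c t := continuous_const.update c continuous_id
  exact (hM.preimage this).mem_nhds (by simpa using hz)

theorem pd_congr (hM : IsOpen M) {f f' : Jet p ι → ℝ} (h : ∀ z ∈ M, f z = f' z) {z : Jet p ι}
    (hz : z ∈ M) (c : Coord p ι) : pd c f z = pd c f' z := by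
  refine Filter.EventuallyEq.deriv_eq ?_
  filter_upwards [eventually_update_mem hM hz c] with t ht using h _ ht

theorem hasDerivAt_update_of_mem (hM : IsOpen M) {s : Finset (Coord p ι)} {f : Jet p ι → ℝ}
    {g : (s → ℝ) → ℝ} (hg : ContDiffOn ℝ ∞ g (restr s '' M)) (hfg : ∀ z ∈ M, f z = g (restr s z))
    {z : Jet p ι} (hz : z ∈ M) {c : Coord p ι} (hc : c ∈ s) :
    HasDerivAt (fun t => f (Function.update z c t))
      (fderiv ℝ g (restr s z) (Pi.single ⟨c, hc⟩ 1)) (z c) := by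
  have h1 : HasFDerivAt g (fderiv ℝ g (restr s z)) (restr s z) :=
    ((hg.contDiffAt ((isOpen_image_restr hM s).mem_nhds ⟨z, hz, rfl⟩)).differentiableAt
      (by simp)).hasFDerivAt
  have h2 : HasDerivAt (fun t => Function.update (restr s z) ⟨c, hc⟩ t)
      (Pi.single ⟨c, hc⟩ 1) (z c) := hasDerivAt_update (restr s z) ⟨c, hc⟩ (z c)
  have h3 : Function.update (restr s z) ⟨c, hc⟩ (z c) = restr s z :=
    Function.update_eq_self (⟨c, hc⟩ : s) (restr s z)
  rw [← h3] at h1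
  have h4 := h1.comp_hasDerivAt (z c) h2
  rw [h3] at h4
  refine h4.congr_of_eventuallyEq ?_
  filter_upwards [eventually_update_mem hM hz c] with t ht
  rw [hfg _ ht, restr_update_of_mem hc]
  rfl

theorem hasDerivAt_update_of_notMem (hM : IsOpen M) {s : Finset (Coord p ι)} {f : Jet p ι → ℝ}
    (hf : IsSmoothIn M s f) {z : Jet p ι} (hz : z ∈ M) {c : Coord p ι} (hc : c ∉ s) :
    HasDerivAt (fun t => f (Function.update z c t)) 0 (z c) := by
  obtain ⟨g, -, hfg⟩ := hf
  refine (hasDerivAt_const (z c) (f z)).congr_of_eventuallyEq ?_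
  filter_upwards [eventually_update_mem hM hz c] with t ht
  rw [hfg _ ht, hfg _ hz, restr_update_of_notMem hc]

theorem pd_eq_fderiv (hM : IsOpen M) {s : Finset (Coord p ι)} {f : Jet p ι → ℝ}
    {g : (s → ℝ) → ℝ} (hg : ContDiffOn ℝ ∞ g (restr s '' M)) (hfg : ∀ z ∈ M, f z = g (restr s z))
    {z : Jet p ι} (hz : z ∈ M) {c : Coord p ι} (hc : c ∈ s) :
    pd c f z = fderiv ℝ g (restr s z) (Pi.single ⟨c, hc⟩ 1) :=
  (hasDerivAt_update_of_mem hM hg hfg hz hc).deriv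

theorem pd_eq_zero (hM : IsOpen M) {s : Finset (Coord p ι)} {f : Jet p ι → ℝ}
    (hf : IsSmoothIn M s f) {z : Jet p ι} (hz : z ∈ M) {c : Coord p ι} (hc : c ∉ s) :
    pd c f z = 0 :=
  (hasDerivAt_update_of_notMem hM hf hz hc).deriv

theorem IsSmoothFun.hasDerivAt_update (hM : IsOpen M) {f : Jet p ι → ℝ} (hf : IsSmoothFun M f)
    {z : Jet p ι} (hz : z ∈ M) (c : Coord p ι) :
    HasDerivAt (fun t => f (Function.update z c t)) (pd c f z) (z c) := by
  obtain ⟨s, g, hg, hfg⟩ := hf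
  refine DifferentiableAt.hasDerivAt ?_
  by_cases hc : c ∈ s
  · exact (hasDerivAt_update_of_mem hM hg hfg hz hc).differentiableAt
  · exact (hasDerivAt_update_of_notMem hM ⟨g, hg, hfg⟩ hz hc).differentiableAt

theorem IsSmoothIn.pd (hM : IsOpen M) {s : Finset (Coord p ι)} {f : Jet p ι → ℝ}
    (hf : IsSmoothIn M s f) (c : Coord p ι) : IsSmoothIn M s (pd c f) := by
  by_cases hc : c ∈ s
  · obtain ⟨g, hg, hfg⟩ := hf
    exact ⟨fun y => fderiv ℝ g y (Pi.single ⟨c, hc⟩ 1),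
      (hg.fderiv_of_isOpen (isOpen_image_restr hM s) (by simp)).clm_apply contDiffOn_const,
      fun z hz => pd_eq_fderiv hM hg hfg hz hc⟩
  · exact ⟨0, contDiffOn_const, fun z hz => pd_eq_zero hM hf hz hc⟩

theorem IsSmoothFun.pd (hM : IsOpen M) {f : Jet p ι → ℝ}
    (hf : IsSmoothFun M f) (c : Coord p ι) : IsSmoothFun M (pd c f) := by
  obtain ⟨s, hs⟩ := hf
  exact ⟨s, IsSmoothIn.pd hM hs c⟩

theorem pd_add (hM : IsOpen M) {f f' : Jet p ι → ℝ} (hf : IsSmoothFun M f)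
    (hf' : IsSmoothFun M f') {z : Jet p ι} (hz : z ∈ M) (c : Coord p ι) :
    pd c (fun z => f z + f' z) z = pd c f z + pd c f' z :=
  ((hf.hasDerivAt_update hM hz c).add (hf'.hasDerivAt_update hM hz c)).deriv

theorem pd_mul (hM : IsOpen M) {f f' : Jet p ι → ℝ} (hf : IsSmoothFun M f)
    (hf' : IsSmoothFun M f') {z : Jet p ι} (hz : z ∈ M) (c : Coord p ι) :
    pd c (fun z => f z * f' z) z = pd c f z * f' z + f z * pd c f' z := by
  have := ((hf.hasDerivAt_update hM hz c).mul (hf'.hasDerivAt_update hM hz c)).deriv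
  simp only [Function.update_eq_self] at this
  exact this

theorem pd_const (a : ℝ) (c : Coord p ι) (z : Jet p ι) : pd c (fun _ => a) z = 0 := by
  simp [pd]

theorem pd_coord (c d : Coord p ι) (z : Jet p ι) :
    pd c (fun z => z d) z = if d = c then 1 else 0 := by
  by_cases h : d = c
  · subst h
    simp [pd]
  · simp [pd, h]

theorem pd_comm (hM : IsOpen M) {f : Jet p ι → ℝ} (hf : IsSmoothFun M f)
    {z : Jet p ι} (hz : z ∈ M) (c d : Coord p ι) :
    pd c (pd d f) z = pd d (pd c f) z := by
  -- With both `c` and `d` in `s`, either order of differentiation is a value of the second Fréchet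
  -- derivative of `g`, which is symmetric.
  obtain ⟨s, hcd, ⟨g, hg, hfg⟩, -⟩ := hf.exists_common hf {c, d}
  have hc : c ∈ s := hcd (by simp)
  have hd : d ∈ s := hcd (by simp)
  have hO := isOpen_image_restr hM s
  have hg' : ContDiffOn ℝ ∞ (fderiv ℝ g) (restr s '' M) :=
    hg.fderiv_of_isOpen (m := ∞) hO (by simp)
  have key : ∀ (e : Coord p ι) (he : e ∈ s) (e' : Coord p ι) (he' : e' ∈ s), pd e (pd e' f) z =
      fderiv ℝ (fderiv ℝ g) (restr s z) (Pi.single ⟨e, he⟩ 1) (Pi.single ⟨e', he'⟩ 1) := by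
    intro e he e' he'
    rw [pd_eq_fderiv hM (g := fun y => fderiv ℝ g y (Pi.single ⟨e', he'⟩ 1))
      (hg'.clm_apply contDiffOn_const) (fun z hz => pd_eq_fderiv hM hg hfg hz he') hz he]
    rw [fderiv_clm_apply ((hg'.contDiffAt (hO.mem_nhds ⟨z, hz, rfl⟩)).differentiableAt (by simp))
      (by fun_prop)]
    simp
  rw [key c hc d hd, key d hd c hc]
  have hsymm := (hg.contDiffAt (hO.mem_nhds ⟨z, hz, rfl⟩)).isSymmSndFDerivAt
    (by rw [minSmoothness_of_isRCLikeNormedField]; exact WithTop.coe_le_coe.2 le_top)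
  exact hsymm _ _

end PartialDerivatives

/-! ### Coefficients of the vector fields. -/

section Coefficients

variable {p : ℕ} {ι : Type} {M : Set (Jet p ι)}

/-- The action of the total derivative `D_i` on the jet coordinates. -/
def shift (i : Fin p) : Coord p ι → Jet p ι → ℝ
  | Sum.inl k => fun _ => if k = i then 1 else 0
  | Sum.inr (a, J) => fun z => z (Sum.inr (a, J + Pi.single i 1))

theorem isSmoothFun_shift (i : Fin p) (c : Coord p ι) : IsSmoothFun M (shift i c) := by
  rcases c with k | ⟨a, J⟩
  · exact isSmoothFun_const _
  · exact isSmoothFun_coord _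

theorem IsSmoothFun.characteristic {ξ : Fin p → Jet p ι → ℝ} {φ : ι → Jet p ι → ℝ}
    (h : IsVectorField M ξ φ) (a : ι) : IsSmoothFun M (characteristic ξ φ a) :=
  (h.2 a).sub (IsSmoothFun.sum _ fun i _ => (h.1 i).mul (isSmoothFun_coord _))

end Coefficients

/-! ### Total derivatives and prolongations as derivations. -/

section Derivations

variable {p : ℕ} {ι : Type} [DecidableEq ι] {M : Set (Jet p ι)}

/-- On smooth differential functions on `M`, the operator `T` is the vector field
`∑ c, w c ∂/∂c`. -/
def ActsBy (M : Set (Jet p ι)) (w : Coord p ι → Jet p ι → ℝ)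
    (T : (Jet p ι → ℝ) → Jet p ι → ℝ) : Prop :=
  ∀ (s : Finset (Coord p ι)) (f : Jet p ι → ℝ), IsSmoothIn M s f → ∀ z ∈ M,
    T f z = ∑ c ∈ s, w c z * pd c f z

namespace ActsBy

variable {w : Coord p ι → Jet p ι → ℝ} {T : (Jet p ι → ℝ) → Jet p ι → ℝ}

theorem congr (h : ActsBy M w T) (hM : IsOpen M) {f f' : Jet p ι → ℝ} (hf : IsSmoothFun M f)
    (hff' : ∀ z ∈ M, f z = f' z) {z : Jet p ι} (hz : z ∈ M) : T f z = T f' z := by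
  obtain ⟨s, hs⟩ := hf
  rw [h s f hs z hz, h s f' (IsSmoothIn.congr hs fun z hz => (hff' z hz).symm) z hz]
  exact Finset.sum_congr rfl fun c _ => by rw [pd_congr hM hff' hz]

theorem add (h : ActsBy M w T) (hM : IsOpen M) {f f' : Jet p ι → ℝ} (hf : IsSmoothFun M f)
    (hf' : IsSmoothFun M f') {z : Jet p ι} (hz : z ∈ M) :
    T (fun z => f z + f' z) z = T f z + T f' z := by
  obtain ⟨s, -, hs, hs'⟩ := hf.exists_common hf' ∅
  obtain ⟨t, hst, ht, -⟩ := (hf.add hf').exists_common hf s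
  rw [h t _ ht z hz, h t _ (hs.mono hst) z hz, h t _ (hs'.mono hst) z hz,
    ← Finset.sum_add_distrib]
  exact Finset.sum_congr rfl fun c _ => by rw [pd_add hM hf hf' hz, mul_add]

theorem mul (h : ActsBy M w T) (hM : IsOpen M) {f f' : Jet p ι → ℝ} (hf : IsSmoothFun M f)
    (hf' : IsSmoothFun M f') {z : Jet p ι} (hz : z ∈ M) :
    T (fun z => f z * f' z) z = T f z * f' z + f z * T f' z := by
  obtain ⟨s, -, hs, hs'⟩ := hf.exists_common hf' ∅
  obtain ⟨t, hst, ht, -⟩ := (hf.mul hf').exists_common hf s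
  rw [h t _ ht z hz, h t _ (hs.mono hst) z hz, h t _ (hs'.mono hst) z hz,
    Finset.sum_mul, Finset.mul_sum, ← Finset.sum_add_distrib]
  refine Finset.sum_congr rfl fun c _ => ?_
  rw [pd_mul hM hf hf' hz]
  ring

theorem const (h : ActsBy M w T) (a : ℝ) {z : Jet p ι} (hz : z ∈ M) : T (fun _ => a) z = 0 := by
  obtain ⟨s, hs⟩ := isSmoothFun_const (M := M) a
  rw [h s _ hs z hz]
  exact Finset.sum_eq_zero fun c _ => by rw [pd_const, mul_zero]

theorem coord (h : ActsBy M w T) (c : Coord p ι) {z : Jet p ι} (hz : z ∈ M) :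
    T (fun z => z c) z = w c z := by
  obtain ⟨s, hcs, hs, -⟩ := (isSmoothFun_coord (M := M) c).exists_common (isSmoothFun_coord c) {c}
  rw [h s _ hs z hz, Finset.sum_eq_single c]
  · simp [pd_coord]
  · intro d _ hd
    simp [pd_coord, hd.symm]
  · intro hc
    exact absurd (hcs (Finset.mem_singleton_self c)) hc

theorem neg (h : ActsBy M w T) (hM : IsOpen M) {f : Jet p ι → ℝ} (hf : IsSmoothFun M f)
    {z : Jet p ι} (hz : z ∈ M) : T (fun z => -f z) z = -T f z := by
  have := h.mul hM (isSmoothFun_const (-1)) hf hz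
  simpa [h.const _ hz] using this

theorem sum (h : ActsBy M w T) (hM : IsOpen M) {κ : Type} {f : κ → Jet p ι → ℝ} (S : Finset κ)
    (hf : ∀ k ∈ S, IsSmoothFun M (f k)) {z : Jet p ι} (hz : z ∈ M) :
    T (fun z => ∑ k ∈ S, f k z) z = ∑ k ∈ S, T (f k) z := by
  classical
  induction S using Finset.induction_on with
  | empty => simpa using h.const 0 hz
  | insert k S hk ih =>
    have hS : ∀ j ∈ S, IsSmoothFun M (f j) := fun j hj => hf j (Finset.mem_insert_of_mem hj)
    simp only [Finset.sum_insert hk]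
    rw [h.add hM (hf k (Finset.mem_insert_self k S)) (IsSmoothFun.sum S hS) hz, ih hS]

theorem isSmoothFun (h : ActsBy M w T) (hM : IsOpen M) (hw : ∀ c, IsSmoothFun M (w c))
    {f : Jet p ι → ℝ} (hf : IsSmoothFun M f) : IsSmoothFun M (T f) := by
  obtain ⟨s, hs⟩ := hf
  exact (IsSmoothFun.sum s fun c _ => (hw c).mul (IsSmoothFun.pd hM ⟨s, hs⟩ c)).congr
    fun z hz => h s f hs z hz

end ActsBy

theorem finsum_mul_pd_inr (hM : IsOpen M) {s : Finset (Coord p ι)} {f : Jet p ι → ℝ}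
    (hf : IsSmoothIn M s f) {z : Jet p ι} (hz : z ∈ M) (w : ι × MultiIndex p → ℝ) :
    ∑ᶠ c, w c * pd (Sum.inr c) f z = ∑ c ∈ s, Sum.elim (fun _ => 0) w c * pd c f z := by
  -- Adding every `x^i` to `s` splits the sum by kind of coordinate; the new terms vanish.
  have h1 : s ⊆ Finset.univ.disjSum s.toRight := by
    rintro (i | c) h
    · simp
    · simpa using h
  rw [Finset.sum_subset h1 fun c _ hc => by rw [pd_eq_zero hM hf hz hc, mul_zero],
    Finset.sum_disjSum, finsum_eq_sum_of_support_subset (s := s.toRight)]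
  · simp
  · intro c hc
    by_contra h
    refine hc ?_
    simp only
    rw [pd_eq_zero hM hf hz (by simpa using h), mul_zero]

theorem actsBy_totalDeriv (hM : IsOpen M) (i : Fin p) :
    ActsBy M (shift i) (totalDeriv i : (Jet p ι → ℝ) → Jet p ι → ℝ) := by
  intro s f hf z hz
  have h1 : pd (Sum.inl i) f z =
      ∑ c ∈ s, (if c = Sum.inl i then 1 else 0) * pd c f z := by
    by_cases hi : Sum.inl i ∈ s
    · simp [hi]
    · simp [hi, pd_eq_zero hM hf hz hi]
  rw [totalDeriv, finsum_mul_pd_inr hM hf hz, h1, ← Finset.sum_add_distrib]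
  refine Finset.sum_congr rfl fun c _ => ?_
  rcases c with k | ⟨a, J⟩ <;> simp [shift]

theorem IsSmoothFun.totalDeriv (hM : IsOpen M) {f : Jet p ι → ℝ} (hf : IsSmoothFun M f)
    (i : Fin p) : IsSmoothFun M (totalDeriv i f) :=
  (actsBy_totalDeriv hM i).isSmoothFun hM (isSmoothFun_shift i) hf

/-- The first-order part of `D_i D_j f` is symmetric because both shifts add `1_i + 1_j` to the
multi-index, the second-order part because partial derivatives commute. -/
theorem totalDeriv_comm (hM : IsOpen M) {f : Jet p ι → ℝ} (hf : IsSmoothFun M f) (i j : Fin p)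
    {z : Jet p ι} (hz : z ∈ M) :
    totalDeriv i (totalDeriv j f) z = totalDeriv j (totalDeriv i f) z := by
  obtain ⟨s, hs⟩ := id hf
  have key : ∀ i j : Fin p, totalDeriv i (totalDeriv j f) z =
      ∑ c ∈ s, (totalDeriv i (shift j c) z * pd c f z +
        shift j c z * ∑ d ∈ s, shift i d z * pd d (pd c f) z) := by
    intro i j
    have hD := actsBy_totalDeriv (ι := ι) hM i
    have hsm : ∀ c ∈ s, IsSmoothFun M fun z => shift j c z * pd c f z := fun c _ =>
      (isSmoothFun_shift j c).mul (hf.pd hM c)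
    rw [hD.congr hM (hf.totalDeriv hM j) (actsBy_totalDeriv hM j s f hs) hz, hD.sum hM s hsm hz]
    refine Finset.sum_congr rfl fun c _ => ?_
    rw [hD.mul hM (isSmoothFun_shift j c) (hf.pd hM c) hz, hD s _ (IsSmoothIn.pd hM hs c) z hz]
  have hshift : ∀ c : Coord p ι, totalDeriv i (shift j c) z = totalDeriv j (shift i c) z := by
    have hi := actsBy_totalDeriv (ι := ι) hM i
    have hj := actsBy_totalDeriv (ι := ι) hM j
    rintro (k | ⟨a, J⟩)
    · exact (hi.const _ hz).trans (hj.const _ hz).symm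
    · refine (hi.coord _ hz).trans (Eq.trans ?_ (hj.coord _ hz).symm)
      simp only [shift]
      rw [add_right_comm]
  rw [key i j, key j i, Finset.sum_add_distrib, Finset.sum_add_distrib]
  congr 1
  · exact Finset.sum_congr rfl fun c _ => by rw [hshift]
  · simp only [Finset.mul_sum]
    rw [Finset.sum_comm]
    refine Finset.sum_congr rfl fun c _ => Finset.sum_congr rfl fun d _ => ?_
    rw [pd_comm hM hf hz c d]
    ring

/-- The composition of the total derivatives in a list. -/
def totalDerivList (l : List (Fin p)) (f : Jet p ι → ℝ) : Jet p ι → ℝ := l.foldr totalDeriv f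

/-- `D_1, …, D_1, …, D_p, …, D_p`, each `D_i` occurring `j_i` times. -/
def MultiIndex.toList (J : MultiIndex p) : List (Fin p) :=
  (List.finRange p).flatMap fun i => List.replicate (J i) i

theorem MultiIndex.length_toList (J : MultiIndex p) : J.toList.length = J.deg := by
  simp only [MultiIndex.toList, List.length_flatMap, List.length_replicate, MultiIndex.deg]
  exact (Fin.sum_univ_def J).symm

/-- Writing `D_J` as a word turns commutation into permutation of lists and integration by parts
into list induction. -/
theorem totalDerivs_eq_list (J : MultiIndex p) (f : Jet p ι → ℝ) :
    totalDerivs J f = totalDerivList J.toList f := by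
  unfold totalDerivs totalDerivList MultiIndex.toList
  induction List.finRange p with
  | nil => rfl
  | cons i l ih =>
    rw [List.foldr_cons, List.flatMap_cons, List.foldr_append, ih]
    generalize List.foldr totalDeriv f _ = g
    induction J i with
    | zero => rfl
    | succ m ihm => rw [Function.iterate_succ_apply', ihm]; rfl

theorem IsSmoothFun.totalDerivList (hM : IsOpen M) {f : Jet p ι → ℝ} (hf : IsSmoothFun M f)
    (l : List (Fin p)) : IsSmoothFun M (totalDerivList l f) := by
  induction l with
  | nil => exact hf
  | cons i l ih => exact ih.totalDeriv hM i

theorem IsSmoothFun.totalDerivs (hM : IsOpen M) {f : Jet p ι → ℝ} (hf : IsSmoothFun M f)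
    (J : MultiIndex p) : IsSmoothFun M (totalDerivs J f) := by
  rw [totalDerivs_eq_list]
  exact hf.totalDerivList hM _

theorem IsSmoothFun.negTotalDerivs (hM : IsOpen M) {f : Jet p ι → ℝ} (hf : IsSmoothFun M f)
    (J : MultiIndex p) : IsSmoothFun M (negTotalDerivs J f) :=
  (isSmoothFun_const _).mul (hf.totalDerivs hM J)

theorem IsSmoothFun.divergence (hM : IsOpen M) {A : Fin p → Jet p ι → ℝ}
    (hA : ∀ i, IsSmoothFun M (A i)) : IsSmoothFun M (divergence A) :=
  IsSmoothFun.sum Finset.univ fun i _ => (hA i).totalDeriv hM i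

theorem totalDerivList_perm (hM : IsOpen M) {l l' : List (Fin p)} (hl : l.Perm l')
    {f : Jet p ι → ℝ} (hf : IsSmoothFun M f) :
    ∀ z ∈ M, totalDerivList l f z = totalDerivList l' f z := by
  induction hl with
  | nil => exact fun _ _ => rfl
  | cons i _ ih =>
    exact fun z hz => (actsBy_totalDeriv hM i).congr hM (hf.totalDerivList hM _) ih hz
  | swap i j l => exact fun z hz => totalDeriv_comm hM (hf.totalDerivList hM l) j i hz
  | trans _ _ ih ih' => exact fun z hz => (ih z hz).trans (ih' z hz)

/-- The action of the prolonged vector field on the jet coordinates. -/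
def prolongCoeff (ξ : Fin p → Jet p ι → ℝ) (φ : ι → Jet p ι → ℝ) (c : Coord p ι) :
    Jet p ι → ℝ :=
  fun z => ∑ i, ξ i z * shift i c z +
    Sum.elim (fun _ => 0) (fun c => totalDerivs c.2 (characteristic ξ φ c.1) z) c

theorem actsBy_prolong (hM : IsOpen M) (ξ : Fin p → Jet p ι → ℝ) (φ : ι → Jet p ι → ℝ) :
    ActsBy M (prolongCoeff ξ φ) (prolong ξ φ) := by
  intro s f hf z hz
  rw [prolong, finsum_mul_pd_inr hM hf hz]
  simp only [actsBy_totalDeriv hM _ s f hf z hz, Finset.mul_sum]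
  rw [Finset.sum_comm, ← Finset.sum_add_distrib]
  refine Finset.sum_congr rfl fun c _ => ?_
  simp only [prolongCoeff, add_mul, Finset.sum_mul, mul_assoc]

/-- The transport term `ξ^i u^a_i` cancels the one subtracted in the characteristic. -/
theorem prolong_coord (hM : IsOpen M) (ξ : Fin p → Jet p ι → ℝ) (φ : ι → Jet p ι → ℝ) (a : ι)
    {z : Jet p ι} (hz : z ∈ M) : prolong ξ φ (fun z => z (Sum.inr (a, 0))) z = φ a z := by
  rw [(actsBy_prolong hM ξ φ).coord _ hz]
  have : totalDerivs 0 (characteristic ξ φ a) = characteristic ξ φ a := by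
    rw [totalDerivs_eq_list]
    have : (0 : MultiIndex p).toList = [] := by
      simp [MultiIndex.toList]
    rw [this]
    rfl
  simp [prolongCoeff, shift, this, characteristic]

theorem isSmoothFun_prolongCoeff (hM : IsOpen M) {ξ : Fin p → Jet p ι → ℝ}
    {φ : ι → Jet p ι → ℝ} (h : IsVectorField M ξ φ) (c : Coord p ι) :
    IsSmoothFun M (prolongCoeff ξ φ c) := by
  refine (IsSmoothFun.sum _ fun i _ => (h.1 i).mul (isSmoothFun_shift i c)).add ?_
  rcases c with i | c
  · exact isSmoothFun_const 0
  · exact (IsSmoothFun.characteristic h c.1).totalDerivs hM c.2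

theorem IsSmoothFun.prolong (hM : IsOpen M) {ξ : Fin p → Jet p ι → ℝ}
    {φ : ι → Jet p ι → ℝ} (h : IsVectorField M ξ φ) {f : Jet p ι → ℝ} (hf : IsSmoothFun M f) :
    IsSmoothFun M (prolong ξ φ f) :=
  (actsBy_prolong hM ξ φ).isSmoothFun hM (isSmoothFun_prolongCoeff hM h) hf

end Derivations

/-! ### Divergences and integration by parts. -/

section Divergences

variable {p : ℕ} {ι : Type} [DecidableEq ι] {M : Set (Jet p ι)}

/-- `h` is the divergence, on `M`, of a tuple of smooth differential functions. -/
def IsDivergence (M : Set (Jet p ι)) (h : Jet p ι → ℝ) : Prop :=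
  ∃ A : Fin p → Jet p ι → ℝ, (∀ i, IsSmoothFun M (A i)) ∧ ∀ z ∈ M, h z = divergence A z

theorem IsDivergence.congr {h h' : Jet p ι → ℝ} (hh : IsDivergence M h)
    (heq : ∀ z ∈ M, h' z = h z) : IsDivergence M h' := by
  obtain ⟨A, hA, hhA⟩ := hh
  exact ⟨A, hA, fun z hz => (heq z hz).trans (hhA z hz)⟩

theorem isDivergence_zero (hM : IsOpen M) : IsDivergence M fun _ => 0 :=
  ⟨fun _ _ => 0, fun _ => isSmoothFun_const 0, fun _ hz =>
    (Finset.sum_eq_zero fun i _ => (actsBy_totalDeriv hM i).const 0 hz).symm⟩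

theorem IsDivergence.add (hM : IsOpen M) {h h' : Jet p ι → ℝ} (hh : IsDivergence M h)
    (hh' : IsDivergence M h') : IsDivergence M fun z => h z + h' z := by
  obtain ⟨A, hA, hhA⟩ := hh
  obtain ⟨A', hA', hhA'⟩ := hh'
  refine ⟨fun i z => A i z + A' i z, fun i => (hA i).add (hA' i), fun z hz => ?_⟩
  simp only
  rw [hhA z hz, hhA' z hz, divergence, divergence, divergence, ← Finset.sum_add_distrib]
  exact Finset.sum_congr rfl fun i _ => ((actsBy_totalDeriv hM i).add hM (hA i) (hA' i) hz).symm

theorem IsDivergence.neg (hM : IsOpen M) {h : Jet p ι → ℝ} (hh : IsDivergence M h) :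
    IsDivergence M fun z => -h z := by
  obtain ⟨A, hA, hhA⟩ := hh
  refine ⟨fun i z => -A i z, fun i => (hA i).neg, fun z hz => ?_⟩
  simp only
  rw [hhA z hz, divergence, divergence, ← Finset.sum_neg_distrib]
  exact Finset.sum_congr rfl fun i _ => ((actsBy_totalDeriv hM i).neg hM (hA i) hz).symm

theorem IsDivergence.sum (hM : IsOpen M) {κ : Type} {h : κ → Jet p ι → ℝ} (S : Finset κ)
    (hh : ∀ k ∈ S, IsDivergence M (h k)) : IsDivergence M fun z => ∑ k ∈ S, h k z := by
  classical
  induction S using Finset.induction_on with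
  | empty => simpa using isDivergence_zero hM
  | insert k S hk ih =>
    simp only [Finset.sum_insert hk]
    exact (hh k (Finset.mem_insert_self k S)).add hM
      (ih fun j hj => hh j (Finset.mem_insert_of_mem hj))

theorem isDivergence_totalDeriv (hM : IsOpen M) (i : Fin p) {f : Jet p ι → ℝ}
    (hf : IsSmoothFun M f) : IsDivergence M (totalDeriv i f) := by
  refine ⟨fun k => if k = i then f else fun _ => 0, fun k => ?_, fun z hz => ?_⟩
  · by_cases hk : k = i <;> simp only [hk, if_true, if_false]
    exacts [hf, isSmoothFun_const 0]
  · rw [divergence, Finset.sum_eq_single i]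
    · simp
    · intro k _ hk
      simpa [hk] using (actsBy_totalDeriv hM k).const 0 hz
    · simp

/-- The outermost `D_i` is moved first, by `P D_i g = D_i(P g) - (D_i P) g`, and ends up innermost
on `P`: hence the reversed list. -/
theorem isDivergence_mul_totalDerivList (hM : IsOpen M) (l : List (Fin p)) {f : Jet p ι → ℝ}
    (hf : IsSmoothFun M f) {P : Jet p ι → ℝ} (hP : IsSmoothFun M P) :
    IsDivergence M fun z => P z * totalDerivList l f z -
      (-1) ^ l.length * totalDerivList l.reverse P z * f z := by
  induction l generalizing P with
  | nil => exact (isDivergence_zero hM).congr fun z _ => by simp [totalDerivList]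
  | cons i l ih =>
    have hl := hf.totalDerivList hM l
    refine ((isDivergence_totalDeriv hM i (hP.mul hl)).add hM
      ((ih (hP.totalDeriv hM i)).neg hM)).congr fun z hz => ?_
    rw [(actsBy_totalDeriv hM i).mul hM hP hl hz]
    have h1 : totalDerivList (i :: l) f z = totalDeriv i (totalDerivList l f) z := rfl
    have h2 : totalDerivList (i :: l).reverse P z =
        totalDerivList l.reverse (totalDeriv i P) z := by
      simp [totalDerivList]
    rw [h1, h2, List.length_cons, pow_succ]
    ring

/-- Integration by parts. -/
theorem isDivergence_mul_totalDerivs (hM : IsOpen M) (J : MultiIndex p) {f : Jet p ι → ℝ}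
    (hf : IsSmoothFun M f) {P : Jet p ι → ℝ} (hP : IsSmoothFun M P) :
    IsDivergence M fun z => P z * totalDerivs J f z - negTotalDerivs J P z * f z := by
  refine (isDivergence_mul_totalDerivList hM J.toList hf hP).congr fun z hz => ?_
  rw [negTotalDerivs, totalDerivs_eq_list, totalDerivs_eq_list, J.length_toList,
    totalDerivList_perm hM (List.reverse_perm J.toList) hP z hz]

end Divergences

/-! ### Existence of the multipliers. -/

section Multipliers

variable {p q n : ℕ} {M : Set (Jet p (Fin q))}

theorem IsAnalyticFun.isSmoothFun {ι : Type} {M : Set (Jet p ι)} {f : Jet p ι → ℝ}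
    (hM : IsOpen M) (hf : IsAnalyticFun n M f) : IsSmoothFun M f := by
  obtain ⟨s, g, -, hg, hfg⟩ := hf
  exact ⟨s, g, hg.contDiffOn (isOpen_image_restr hM s).uniqueDiffOn, hfg⟩

theorem MultiIndex.finite_deg_le (k : ℕ) : {J : MultiIndex p | J.deg ≤ k}.Finite := by
  refine (Set.finite_Iic (fun _ => k : MultiIndex p)).subset fun J hJ i => ?_
  exact (Finset.single_le_sum (f := J) (fun _ _ => Nat.zero_le _) (Finset.mem_univ i)).trans hJ

/-- The Jacobian rows over all jet coordinates are the images of the differentials under one linear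
map, extension by zero off `s`, and independence of images gives independence. -/
theorem linearIndependent_fderiv_of_pd {ι R : Type} [DecidableEq ι] {M : Set (Jet p ι)}
    (hM : IsOpen M) {s : Finset (Coord p ι)} {H : R → Jet p ι → ℝ} {G : R → (s → ℝ) → ℝ}
    (hG : ∀ r, ContDiffOn ℝ ∞ (G r) (restr s '' M)) (hHG : ∀ r, ∀ z ∈ M, H r z = G r (restr s z))
    {z : Jet p ι} (hz : z ∈ M) (hli : LinearIndependent ℝ fun r c => pd c (H r) z) :
    LinearIndependent ℝ fun r => fderiv ℝ (G r) (restr s z) := by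
  let Φ : ((s → ℝ) →L[ℝ] ℝ) →ₗ[ℝ] (Coord p ι → ℝ) :=
    { toFun := fun A c => if h : c ∈ s then A (Pi.single ⟨c, h⟩ 1) else 0
      map_add' := fun A B => by
        ext c
        by_cases h : c ∈ s <;> simp [h]
      map_smul' := fun a A => by
        ext c
        by_cases h : c ∈ s <;> simp [h] }
  refine LinearIndependent.of_comp Φ ?_
  convert! hli using 2 with r
  ext c
  by_cases h : c ∈ s
  · simp [Φ, h, pd_eq_fderiv hM (hG r) (hHG r) hz h]
  · simp [Φ, h, pd_eq_zero hM ⟨G r, hG r, hHG r⟩ hz h]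

theorem exists_isMultiplier (hM : IsOpen M) {F : Fin q → Jet p (Fin q) → ℝ}
    (hF : ∀ α, IsSmoothFun M (F α)) (hnd : IsTotallyNondegenerate n M F)
    {ξ : Fin p → Jet p (Fin q) → ℝ} {φ : Fin q → Jet p (Fin q) → ℝ} (hX : IsSymmetry M F ξ φ) :
    ∃ (S : Finset (MultiIndex p)) (K : MultiIndex p → Fin q → Fin q → Jet p (Fin q) → ℝ),
      IsMultiplier M F ξ φ S K := by
  classical
  obtain ⟨s₀, -, hs₀⟩ := exists_isSmoothIn_of_finite
    (fun α => (hF α).prolong hM hX.1) ∅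
  let k := s₀.sup Coord.order
  have hfin := MultiIndex.finite_deg_le (p := p) k
  let R : Type := {J : MultiIndex p // J.deg ≤ k} × Fin q
  have : Fintype {J : MultiIndex p // J.deg ≤ k} := hfin.fintype
  obtain ⟨s, hss, hs⟩ := exists_isSmoothIn_of_finite
    (f := fun r : R => totalDerivs r.1.1 (F r.2)) (fun r => (hF r.2).totalDerivs hM r.1.1) s₀
  choose G hG hHG using hs
  have hO := isOpen_image_restr hM s
  have key : ∀ α, ∃ c : R → (s → ℝ) → ℝ, (∀ r, ContDiffOn ℝ ∞ (c r) (restr s '' M)) ∧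
      ∀ z ∈ M, prolong ξ φ (F α) z = ∑ r, c r (restr s z) * G r (restr s z) := by
    intro α
    obtain ⟨g, hg, hfg⟩ := (hs₀ α).mono hss
    have hzero : ∀ z ∈ M, (∀ r, G r (restr s z) = 0) →
        ∀ (J : MultiIndex p) (β : Fin q), J.deg ≤ k → totalDerivs J (F β) z = 0 :=
      fun z hz h J β hJ => (hHG (⟨J, hJ⟩, β) z hz).trans (h _)
    obtain ⟨c, hc, hcg⟩ := exists_eq_sum_mul_of_regular_zeros hO hG hg
      (by
        rintro _ ⟨z, hz, rfl⟩ h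
        obtain ⟨-, U, f, hf, hU, hjet⟩ := hnd k z hz (hzero z hz h)
        -- The comparison with the solution uses `s₀`, whose coordinates have order at most `k`; the
        -- orders in the larger set `s` are not controlled.
        obtain ⟨g₀, -, hfg₀⟩ := hs₀ α
        rw [← hfg z hz, hfg₀ z hz]
        have hx := hX.2 U f hf _ hU α
        rw [hfg₀ _ (hf.2.2 _ hU).1] at hx
        rw [← hx]
        congr 1
        ext c
        exact (hjet c ((Finset.le_sup (f := Coord.order) c.2).trans (Nat.le_add_left _ _))).symm)
      (by
        rintro _ ⟨z, hz, rfl⟩ h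
        exact linearIndependent_fderiv_of_pd hM hG hHG hz (hnd k z hz (hzero z hz h)).1)
    exact ⟨c, hc, fun z hz => (hfg z hz).trans (hcg _ ⟨z, hz, rfl⟩)⟩
  choose c hc hcF using key
  refine ⟨hfin.toFinset, fun J α β z => if hJ : J.deg ≤ k then c α (⟨J, hJ⟩, β) (restr s z) else 0,
    fun J hJ α β => ?_, fun z hz α => ?_⟩
  · have hJ' : J.deg ≤ k := by simpa using hJ
    exact ⟨s, c α (⟨J, hJ'⟩, β), hc _ _, fun z _ => by simp [hJ']⟩
  · rw [hcF α z hz, Fintype.sum_prod_type_right]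
    refine Finset.sum_congr rfl fun β _ => ?_
    rw [Finset.sum_subtype hfin.toFinset (p := fun J => J.deg ≤ k) (by simp)]
    refine Finset.sum_congr rfl fun J _ => ?_
    rw [← hHG (J, β) z hz]
    simp [J.2]

end Multipliers

/-! ### Passage to jets with dummy variables, and the extended symmetry. -/

section Lift

variable {p q : ℕ} {M : Set (Jet p (Fin q))}

theorem continuous_projU : Continuous (projU (p := p) (q := q)) := by
  refine continuous_pi fun c => ?_
  rcases c with i | ⟨α, J⟩
  · exact continuous_apply (Sum.inl i)
  · exact continuous_apply (Sum.inr (Sum.inl α, J))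

/-- The coordinates of the jets `(x,[u])` among those of the jets `(x,[u;v])`. -/
def coordU : Coord p (Fin q) → Coord p (Fin q ⊕ Fin q) := Sum.map id (Prod.map Sum.inl id)

theorem coordU_injective : Function.Injective (coordU (p := p) (q := q)) :=
  Function.injective_id.sumMap (Sum.inl_injective.prodMap Function.injective_id)

theorem projU_apply (w : JetUV p q) (c : Coord p (Fin q)) : projU w c = w (coordU c) := by
  rcases c with i | ⟨α, J⟩ <;> rfl

theorem projU_update_coordU (w : JetUV p q) (c : Coord p (Fin q)) (t : ℝ) :
    projU (Function.update w (coordU c) t) = Function.update (projU w) c t := by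
  ext d
  rw [projU_apply]
  by_cases h : d = c
  · subst h
    simp
  · rw [Function.update_of_ne (coordU_injective.ne h), Function.update_of_ne h, projU_apply]

theorem projU_update_inr (w : JetUV p q) (α : Fin q) (J : MultiIndex p) (t : ℝ) :
    projU (Function.update w (Sum.inr (Sum.inr α, J)) t) = projU w := by
  ext d
  rw [projU_apply, projU_apply, Function.update_of_ne]
  rcases d with i | ⟨β, I⟩ <;> simp [coordU]

theorem pd_coordU_liftU (f : Jet p (Fin q) → ℝ) (w : JetUV p q) (c : Coord p (Fin q)) :
    pd (coordU c) (liftU f) w = pd c f (projU w) := by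
  simp only [pd, liftU, projU_update_coordU, projU_apply]

theorem pd_inr_liftU (f : Jet p (Fin q) → ℝ) (w : JetUV p q) (α : Fin q) (J : MultiIndex p) :
    pd (Sum.inr (Sum.inr α, J)) (liftU f) w = 0 := by
  simp [pd, liftU, projU_update_inr]

/-- Derivatives in the `v` coordinates vanish on a lifted function, so the weights `W` there play no
role. -/
theorem finsum_mul_pd_liftU (f : Jet p (Fin q) → ℝ) (w : JetUV p q)
    (W : (Fin q ⊕ Fin q) × MultiIndex p → ℝ) :
    ∑ᶠ c, W c * pd (Sum.inr c) (liftU f) w =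
      ∑ᶠ c : Fin q × MultiIndex p, W (Sum.inl c.1, c.2) * pd (Sum.inr c) f (projU w) := by
  have hinj : Function.Injective
      (Prod.map Sum.inl id : Fin q × MultiIndex p → (Fin q ⊕ Fin q) × MultiIndex p) :=
    Sum.inl_injective.prodMap Function.injective_id
  have h1 := finsum_mem_range (f := fun c => W c * pd (Sum.inr c) (liftU f) w) hinj
  rw [finsum_mem_def, Set.indicator_eq_self.2] at h1
  · rw [h1]
    refine finsum_congr fun c => ?_
    rw [← pd_coordU_liftU]
    rfl
  · rintro ⟨α | α, J⟩ hc
    · exact ⟨(α, J), rfl⟩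
    · exact absurd (by simp only; rw [pd_inr_liftU, mul_zero]) hc

theorem totalDeriv_liftU (i : Fin p) (f : Jet p (Fin q) → ℝ) :
    totalDeriv i (liftU f) = liftU (totalDeriv i f) := by
  ext w
  rw [totalDeriv, finsum_mul_pd_liftU]
  change pd (coordU (Sum.inl i)) (liftU f) w + _ = _
  rw [pd_coordU_liftU]
  rfl

theorem totalDerivs_liftU (J : MultiIndex p) (f : Jet p (Fin q) → ℝ) :
    totalDerivs J (liftU f) = liftU (totalDerivs J f) := by
  rw [totalDerivs_eq_list, totalDerivs_eq_list]
  induction J.toList with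
  | nil => rfl
  | cons i l ih =>
    exact (congrArg (totalDeriv i) ih).trans (totalDeriv_liftU i _)

theorem divergence_liftU (A : Fin p → Jet p (Fin q) → ℝ) :
    divergence (fun i => liftU (A i)) = liftU (divergence A) := by
  ext w
  simp only [divergence, totalDeriv_liftU, liftU]

/-- The characteristics in the `u` directions do not involve `ψ`, so any extension of `X` acts on
functions of `(x,[u])` as `X` does. -/
theorem prolong_liftU (ξ : Fin p → Jet p (Fin q) → ℝ) (φ : Fin q → Jet p (Fin q) → ℝ)
    (ψ : Fin q → JetUV p q → ℝ) (f : Jet p (Fin q) → ℝ) :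
    prolong (fun i => liftU (ξ i)) (Sum.elim (fun α => liftU (φ α)) ψ) (liftU f) =
      liftU (prolong ξ φ f) := by
  ext w
  rw [prolong, finsum_mul_pd_liftU]
  have h : ∀ α, characteristic (fun i => liftU (ξ i)) (Sum.elim (fun α => liftU (φ α)) ψ)
      (Sum.inl α) = liftU (characteristic ξ φ α) := fun α => rfl
  simp only [h, totalDerivs_liftU, totalDeriv_liftU]
  rfl

theorem IsSmoothFun.liftU {f : Jet p (Fin q) → ℝ} (hf : IsSmoothFun M f) :
    IsSmoothFun (projU ⁻¹' M) (liftU f) := by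
  obtain ⟨s, g, hg, hfg⟩ := hf
  have hmem : ∀ c : s, coordU (c : Coord p (Fin q)) ∈ s.map ⟨coordU, coordU_injective⟩ :=
    fun c => Finset.mem_map_of_mem _ c.2
  have hproj : ∀ w : JetUV p q, (fun c : s => restr (s.map ⟨coordU, coordU_injective⟩) w
      ⟨coordU c, hmem c⟩) = restr s (projU w) := fun w => by
    ext c
    exact (projU_apply w c).symm
  refine ⟨s.map ⟨coordU, coordU_injective⟩, fun y => g fun c => y ⟨coordU c, hmem c⟩, ?_, ?_⟩
  · refine hg.comp (f := fun (y : s.map ⟨coordU, coordU_injective⟩ → ℝ) (c : s) =>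
      y ⟨coordU c, hmem c⟩) (ContDiff.contDiffOn (contDiff_pi.2 fun c => contDiff_apply ℝ ℝ _)) ?_
    rintro _ ⟨w, hw, rfl⟩
    exact ⟨projU w, hw, (hproj w).symm⟩
  · intro w hw
    exact (hfg _ hw).trans (congrArg g (hproj w).symm)

theorem IsDivergence.liftU {h : Jet p (Fin q) → ℝ} (hh : IsDivergence M h) :
    IsDivergence (projU ⁻¹' M) (liftU h) := by
  obtain ⟨A, hA, hhA⟩ := hh
  refine ⟨fun i => FormalLagrangian.liftU (A i), fun i => (hA i).liftU, fun w hw => ?_⟩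
  rw [divergence_liftU]
  exact hhA _ hw

theorem isVariationalSymmetry_modifiedLagrangian (hM : IsOpen M)
    {F : Fin q → Jet p (Fin q) → ℝ} (hF : ∀ α, IsSmoothFun M (F α))
    {ξ : Fin p → Jet p (Fin q) → ℝ} {φ : Fin q → Jet p (Fin q) → ℝ}
    {L₀ : Jet p (Fin q) → ℝ} (hL : IsSmoothFun M L₀) (hinv : IsVariationalSymmetry M L₀ ξ φ)
    {S : Finset (MultiIndex p)} {K : MultiIndex p → Fin q → Fin q → Jet p (Fin q) → ℝ}
    (hK : IsMultiplier M F ξ φ S K) :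
    IsVariationalSymmetry (projU ⁻¹' M) (modifiedLagrangian F L₀) (fun i => liftU (ξ i))
      (Sum.elim (fun α => liftU (φ α)) (phiStar ξ S K)) := by
  have hM' : IsOpen (projU ⁻¹' M : Set (JetUV p q)) := hM.preimage continuous_projU
  obtain ⟨⟨hξ, hφ⟩, hdiv⟩ := hinv
  have hv : ∀ α, IsSmoothFun (projU ⁻¹' M) (vCoord (p := p) (q := q) α) := fun α =>
    isSmoothFun_coord _
  have hvK : ∀ J ∈ S, ∀ β α,
      IsSmoothFun (projU ⁻¹' M) fun w => vCoord β w * liftU (K J β α) w :=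
    fun J hJ β α => (hv β).mul (hK.1 J hJ β α).liftU
  have hY : IsVectorField (projU ⁻¹' M) (fun i => liftU (ξ i))
      (Sum.elim (fun α => liftU (φ α)) (phiStar ξ S K)) := by
    refine ⟨fun i => (hξ i).liftU, ?_⟩
    rintro (α | α)
    · exact (hφ α).liftU
    · refine IsSmoothFun.neg (IsSmoothFun.add (IsSmoothFun.sum _ fun β _ =>
        IsSmoothFun.sum S fun J hJ => (hvK J hJ β α).negTotalDerivs hM' J)
        ((hv α).mul (IsSmoothFun.divergence hM' fun i => (hξ i).liftU)))
  refine ⟨hY, ?_⟩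
  have hpr := actsBy_prolong hM' (fun i => liftU (ξ i))
    (Sum.elim (fun α => liftU (φ α)) (phiStar ξ S K))
  -- The integration by parts remainders plus the balance term; the rest of the proof identifies
  -- this sum with `pr Y(L̂) + L̂ D_i ξ^i`.
  have hd : IsDivergence (projU ⁻¹' M) fun w => (∑ α, ∑ β, ∑ J ∈ S,
      (vCoord β w * liftU (K J β α) w * totalDerivs J (liftU (F α)) w -
        negTotalDerivs J (fun w' => vCoord β w' * liftU (K J β α) w') w * liftU (F α) w)) +
      liftU (fun z => prolong ξ φ L₀ z + L₀ z * divergence ξ z) w :=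
    (IsDivergence.sum hM' _ fun α _ => IsDivergence.sum hM' _ fun β _ =>
      IsDivergence.sum hM' S fun J hJ =>
        isDivergence_mul_totalDerivs hM' J (hF α).liftU (hvK J hJ β α)).add hM'
      (IsDivergence.liftU hdiv)
  refine hd.congr fun w hw => ?_
  have hsm : ∀ α ∈ Finset.univ,
      IsSmoothFun (projU ⁻¹' M) fun w : JetUV p q => vCoord α w * liftU (F α) w :=
    fun α _ => (hv α).mul (hF α).liftU
  have hvpr : ∀ α, prolong (fun i => liftU (ξ i))
      (Sum.elim (fun α => liftU (φ α)) (phiStar ξ S K)) (vCoord α) w = phiStar ξ S K α w :=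
    fun α => prolong_coord hM' _ _ (Sum.inr α) hw
  have hprL : prolong (fun i => liftU (ξ i))
      (Sum.elim (fun α => liftU (φ α)) (phiStar ξ S K)) (modifiedLagrangian F L₀) w =
      ∑ α, (phiStar ξ S K α w * liftU (F α) w +
        vCoord α w * ∑ β, ∑ J ∈ S, liftU (K J α β) w * totalDerivs J (liftU (F β)) w) +
      prolong ξ φ L₀ (projU w) := by
    have h1 := hpr.add hM' (IsSmoothFun.sum _ hsm) hL.liftU hw
    rw [hpr.sum hM' _ hsm hw, prolong_liftU] at h1
    refine h1.trans (congrArg (· + _) (Finset.sum_congr rfl fun α _ => ?_))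
    rw [hpr.mul hM' (hv α) (hF α).liftU hw, hvpr, prolong_liftU]
    simp only [totalDerivs_liftU]
    exact congrArg (fun r => _ + vCoord α w * r) (hK.2 _ hw α)
  -- Renaming the indices collects the coefficient of each `D_J F_α`, matching the transposed
  -- `K^J_{βα}` in `φ_*`.
  have hswap : ∑ α, vCoord α w * ∑ β, ∑ J ∈ S, liftU (K J α β) w * totalDerivs J (liftU (F β)) w =
      ∑ α, ∑ β, ∑ J ∈ S, vCoord β w * liftU (K J β α) w * totalDerivs J (liftU (F α)) w := by
    rw [Finset.sum_comm]
    simp only [Finset.mul_sum, mul_assoc]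
  -- The term `-v^α D_i ξ^i` of `φ_*` cancels the part `v^α F_α D_i ξ^i` of `L̂ D_i ξ^i`.
  rw [hprL, Finset.sum_add_distrib, hswap]
  simp only [modifiedLagrangian, phiStar, Finset.sum_sub_distrib, ← Finset.sum_mul,
    neg_mul, add_mul, Finset.sum_neg_distrib, Finset.sum_add_distrib, divergence_liftU, liftU,
    mul_right_comm]
  ring

end Lift

end FormalLagrangian

end

/-! ### The two halves combined. -/

theorem theorem3p3 (p q n : ℕ)
    -- the domain of definition, and the system `F_α(x,[u]) = 0` of order `n`
    (M : Set (Jet p (Fin q))) (hM : IsJetDomain n M)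
    (F : Fin q → Jet p (Fin q) → ℝ) (hF : ∀ α, IsAnalyticFun n M (F α))
    (hnd : IsTotallyNondegenerate n M F)
    -- the symmetry `X = ξ^i ∂/∂x^i + φ^α ∂/∂u^α`
    (ξ : Fin p → Jet p (Fin q) → ℝ) (φ : Fin q → Jet p (Fin q) → ℝ)
    (hX : IsSymmetry M F ξ φ)
    -- the modified formal Lagrangian `v^α F_α + L₀`
    (L₀ : Jet p (Fin q) → ℝ) (hL : IsModifiedFormalLagrangian M F L₀)
    (hinv : IsVariationalSymmetry M L₀ ξ φ) :
    -- there are functions `K^J_{αβ}` with `pr X (F_α) = ∑ K^J_{αβ} D_J F_β`, and, for every choice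
    -- of them, `Y = X + φ_*^α ∂/∂v^α` is a variational symmetry of `∫ L̂ dx`
    (∃ (S : Finset (MultiIndex p)) (K : MultiIndex p → Fin q → Fin q → Jet p (Fin q) → ℝ),
      IsMultiplier M F ξ φ S K) ∧
    ∀ (S : Finset (MultiIndex p)) (K : MultiIndex p → Fin q → Fin q → Jet p (Fin q) → ℝ),
      IsMultiplier M F ξ φ S K →
        IsVariationalSymmetry (projU ⁻¹' M) (modifiedLagrangian F L₀)
          (fun i => liftU (ξ i))
          (Sum.elim (fun α => liftU (φ α)) (phiStar ξ S K)) :=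
  ⟨exists_isMultiplier hM.isOpen (fun α => (hF α).isSmoothFun hM.isOpen) hnd hX,
    fun _ _ hK => isVariationalSymmetry_modifiedLagrangian hM.isOpen
      (fun α => (hF α).isSmoothFun hM.isOpen) hL.1 hinv hK⟩
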